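/- **Setting.** There are $M$ agents, $N$ linear constraints and a horizon $T$. Agent $i$ has state $X_i(t)\in\mathbb R^{n_i}$ and input $U_i(t)\in\mathbb R^{m_i}$ (scalar if $m_i=1$), with $$X_i(t+1)=A_iX_i(t)+B_iU_i(t)+N_i(t),\qquad 0\le t\le T-1,$$ where $X_i(0)\sim N(0,\Sigma_{i,0})$ and $N_i(t)\sim N(0,P_{i,t})$ are all mutually independent, and $Q_i\succeq 0$, $R_i\succ 0$ are symmetric. The inputs must satisfy $$\sum_{i=1}^M\gamma_{i,n}U_i(t)=0\qquad(1\le n\le N,\ 0\le t\le T-1)$$ with given row vectors $\gamma_{i,n}\in\mathbb R^{1\times m_i}$. (The DC power flow equations are such constraints.) The social welfare is $$-\,\mathbb E\sum_{t=0}^{T-1}\sum_{i=1}^M\big[X_i(t)^\top Q_iX_i(t)+U_i(t)^\top R_iU_i(t)\big].$$ Let $\mathcal F_t$ be the $\sigma$-algebra generated by all $X_i(0)$ and all $N_i(\tau)$, $\tau<t$. An admissible control law is one with every $U_i(t)$ $\mathcal F_t$-measurable and satisfying the constraints almost surely. **Bid-Multiple Price Iteration.** Fix step sizes $\alpha^k>0$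 with $\alpha^k\to0$ and $\sum_k\alpha^k=\infty$. At each time $s=0,\dots,T-1$ the ISO starts from arbitrary prices $\lambda^0_{n,s}(t)$, $s\le t\le T-1$, $1\le n\le N$. In round $k$, agent $i$, using only its own data, its own state $X_i(s)$ and the announced prices, solves the deterministic LQR problem $$\min\sum_{t=s}^{T-1}\Big[x_i(t)^\top Q_ix_i(t)+u_i(t)^\top R_iu_i(t)+\sum_{n=1}^N\lambda^k_{n,s}(t)\,\gamma_{i,n}u_i(t)\Big],\qquad x_i(t+1)=A_ix_i(t)+B_iu_i(t),\ x_i(s)=X_i(s),$$ and bids its solution $u^k_{i,s}(t)$, $s\le t\le T-1$. The ISO then sets $$\lambda^{k+1}_{n,s}(t)=\lambda^k_{n,s}(t)+\alpha^k\sum_{i=1}^M\gamma_{i,n}u^k_{i,s}(t).$$ With $u^\star_{i,s}(t)=\lim_ku^k_{i,s}(t)$, agent $i$ applies $U_i(s)=u^\star_{i,s}(s)$, the states move to time $s+1$, and the procedure is repeated. **Theorem.** 1. Along every realization and at every time $s<T$: in every round each agent's problem has a unique solution; for all $s\le t\le T-1$ the prices converge, $\lambda^k_{n,s}(t)\to\lambda^\star_{n,s}(t)$,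 and the bids converge, $u^k_{i,s}(t)\to u^\star_{i,s}(t)$. The limiting bids are optimal responses to the limiting prices and satisfy $\sum_i\gamma_{i,n}u^\star_{i,s}(t)=0$, and $\lambda^\star_{\cdot,s}$ maximizes the dual function of the deterministic problem of minimizing the agents' total cost over $s\le t\le T-1$ from the states $X_i(s)$ subject to the constraints. 2. The control law produced by the scheme is admissible, has finite expected cost, and attains the maximum of the social welfare over all admissible (centralized) control laws. 3. The resulting prices are optimal stochastic dynamic locational marginal prices: the local price $\pi_i(t)=\sum_n\lambda^\star_{n,t}(t)\gamma_{i,n}$ of agent $i$ is $\mathcal F_t$-measurable, and the process $U_i$ produced by the scheme minimizes $$\mathbb E\sum_{t=0}^{T-1}\big[X_i(t)^\top Q_iX_i(t)+U_i(t)^\top R_iU_i(t)+\pi_i(t)U_i(t)\big]$$ over all square-integrable, $\mathcal F_t$-adapted inputs of agent $i$ that are not subject to the coupling constraints. -/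

import Mathlib

open MeasureTheory ProbabilityTheory Filter Topology Matrix
open scoped ENNReal

noncomputable section

namespace BidPrice

/-- The private data of one agent in a market with `N` linear constraints: the dynamics
`x(t+1) = A x(t) + B u(t) + noise(t)`, the quadratic cost `xᵀ Q x + uᵀ R u`, and the coefficient
row vector `γ n` with which its input enters the `n`-th constraint. Different agents may have
different state and input dimensions (scalar inputs are `nu = 1`). -/
structure Agent (N : ℕ) where
  nx : ℕ
  nu : ℕ
  A : Matrix (Fin nx) (Fin nx) ℝ
  B : Matrix (Fin nx) (Fin nu) ℝ
  Q : Matrix (Fin nx) (Fin nx) ℝ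
  R : Matrix (Fin nu) (Fin nu) ℝ
  γ : Fin N → Fin nu → ℝ
  Q_psd : Q.PosSemidef
  R_pd : R.PosDef

namespace Agent

variable {N : ℕ} (a : Agent N)

/-- State at time `t` of the agent started at time `s` in state `x`, under the inputs `u` and the
noise realization `w` (for `t ≤ s` the value is `x`). -/
def state (s : ℕ) (x : Fin a.nx → ℝ) (u : ℕ → Fin a.nu → ℝ) (w : ℕ → Fin a.nx → ℝ) :
    ℕ → Fin a.nx → ℝ
  | 0 => x
  | t + 1 => if s ≤ t then a.A *ᵥ state s x u w t + a.B *ᵥ u t + w t else x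

/-- The cost `∑_{t=s}^{T-1} [x(t)ᵀ Q x(t) + u(t)ᵀ R u(t)]` along the trajectory started at time
`s` in state `x`, under the inputs `u` and the noise realization `w`. -/
def cost (T s : ℕ) (x : Fin a.nx → ℝ) (u : ℕ → Fin a.nu → ℝ) (w : ℕ → Fin a.nx → ℝ) : ℝ :=
  ∑ t ∈ Finset.Ico s T,
    (a.state s x u w t ⬝ᵥ (a.Q *ᵥ a.state s x u w t) + u t ⬝ᵥ (a.R *ᵥ u t))

/-- The price per unit of its own input that the agent faces when the constraint prices are `p`:
`∑_n p_n γ_n`. -/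
def localPrice (p : Fin N → ℝ) : Fin a.nu → ℝ := ∑ n, p n • a.γ n

/-- The cost of the agent plus its payments `∑_{t=s}^{T-1} π(t) · u(t)` at local prices `π`. -/
def netCost (T s : ℕ) (x : Fin a.nx → ℝ) (π u : ℕ → Fin a.nu → ℝ) (w : ℕ → Fin a.nx → ℝ) : ℝ :=
  a.cost T s x u w + ∑ t ∈ Finset.Ico s T, π t ⬝ᵥ u t

/-- `u` solves the agent's deterministic (noise-free) LQR problem over `s ≤ t ≤ T-1`, started in
state `x`, at the constraint prices `p t n`. -/
def IsOptimalBid (T s : ℕ) (x : Fin a.nx → ℝ) (p : ℕ → Fin N → ℝ) (u : ℕ → Fin a.nu → ℝ) : Prop :=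
  ∀ v : ℕ → Fin a.nu → ℝ,
    a.netCost T s x (fun t => a.localPrice (p t)) u 0 ≤
      a.netCost T s x (fun t => a.localPrice (p t)) v 0

/-- The bid of the agent: an optimal solution of its deterministic LQR problem. It depends on
nothing but the agent's own data, its own current state and the announced prices. -/
def bid (T s : ℕ) (x : Fin a.nx → ℝ) (p : ℕ → Fin N → ℝ) : ℕ → Fin a.nu → ℝ :=
  Classical.epsilon (a.IsOptimalBid T s x p)

end Agent

variable {M N : ℕ} (S : Fin M → Agent N)

/-- Left-hand side of the `n`-th constraint, `∑_i γ_{i,n} u_i`. -/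
def excess (u : ∀ i, Fin (S i).nu → ℝ) (n : Fin N) : ℝ := ∑ i, (S i).γ n ⬝ᵥ u i

/-- The prices `λ^k_{n,s}(t)`, as `priceIter … k t n`, announced in round `k` at time `s` when the
agents are in the states `x` and the initial prices are `p₀`. -/
def priceIter (T : ℕ) (α : ℕ → ℝ) (s : ℕ) (x : ∀ i, Fin (S i).nx → ℝ) (p₀ : ℕ → Fin N → ℝ) :
    ℕ → ℕ → Fin N → ℝ
  | 0 => p₀
  | k + 1 => fun t n =>
      priceIter T α s x p₀ k t n +
        α k * excess S (fun i => (S i).bid T s (x i) (priceIter T α s x p₀ k) t) n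

/-- The bid `u^k_{i,s}` of agent `i` in round `k` at time `s`. -/
def bidIter (T : ℕ) (α : ℕ → ℝ) (s : ℕ) (x : ∀ i, Fin (S i).nx → ℝ) (p₀ : ℕ → Fin N → ℝ)
    (k : ℕ) (i : Fin M) : ℕ → Fin (S i).nu → ℝ :=
  (S i).bid T s (x i) (priceIter S T α s x p₀ k)

/-- The limiting prices `λ^⋆_{n,s}(t)`. -/
def limitPrice (T : ℕ) (α : ℕ → ℝ) (s : ℕ) (x : ∀ i, Fin (S i).nx → ℝ) (p₀ : ℕ → Fin N → ℝ)
    (t : ℕ) (n : Fin N) : ℝ :=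
  limUnder atTop (fun k => priceIter S T α s x p₀ k t n)

/-- The limiting bids `u^⋆_{i,s}(t)`. -/
def limitBid (T : ℕ) (α : ℕ → ℝ) (s : ℕ) (x : ∀ i, Fin (S i).nx → ℝ) (p₀ : ℕ → Fin N → ℝ)
    (i : Fin M) (t : ℕ) : Fin (S i).nu → ℝ :=
  limUnder atTop (fun k => bidIter S T α s x p₀ k i t)

/-- The dual function of the deterministic social planning problem over `s ≤ t ≤ T-1`, with
initial states `x`: the infimum over all inputs of the Lagrangian. -/
def dualFunction (T s : ℕ) (x : ∀ i, Fin (S i).nx → ℝ) (p : ℕ → Fin N → ℝ) : EReal :=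
  ⨅ u : (i : Fin M) → ℕ → Fin (S i).nu → ℝ,
    ((∑ i, (S i).cost T s (x i) (u i) 0 +
      ∑ t ∈ Finset.Ico s T, ∑ n, p t n * excess S (fun i => u i t) n : ℝ) : EReal)

/-- The states at time `s` when, at every time, the first entries of the limiting bids are
applied. The initial states are `x₀`, the noise realization is `w`, and `p₀ s` are the prices with
which the iteration at time `s` starts. -/
def loopState (T : ℕ) (α : ℕ → ℝ) (p₀ : ℕ → ℕ → Fin N → ℝ)
    (x₀ : ∀ i, Fin (S i).nx → ℝ) (w : (i : Fin M) → ℕ → Fin (S i).nx → ℝ) :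
    ℕ → ∀ i, Fin (S i).nx → ℝ
  | 0 => x₀
  | s + 1 => fun i =>
      (S i).A *ᵥ loopState T α p₀ x₀ w s i +
        (S i).B *ᵥ limitBid S T α s (loopState T α p₀ x₀ w s) (p₀ s) i s + w i s

section Stochastic

variable {Ω : Type*} [MeasurableSpace Ω]

/-- All the primitive random vectors: the initial states `X₀ i` and the noises `W i t`, `t < T`. -/
def primitives (T : ℕ) (X₀ : (i : Fin M) → Ω → Fin (S i).nx → ℝ)
    (W : (i : Fin M) → ℕ → Ω → Fin (S i).nx → ℝ) :
    (q : Fin M × Option (Fin T)) → Ω → Fin (S q.1).nx → ℝ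
  | (i, none) => X₀ i
  | (i, some t) => W i t

/-- The centralized information at time `t`: all the initial states and all the noises that have
acted on the states up to time `t`, that is `W i 0, …, W i (t-1)`. -/
@[reducible] def info (X₀ : (i : Fin M) → Ω → Fin (S i).nx → ℝ)
    (W : (i : Fin M) → ℕ → Ω → Fin (S i).nx → ℝ) (t : ℕ) : MeasurableSpace Ω :=
  (⨆ i, MeasurableSpace.comap (X₀ i) inferInstance) ⊔
    ⨆ i, ⨆ r : Fin t, MeasurableSpace.comap (W i r) inferInstance

/-- Admissible centralized control laws: adapted to the centralized information, and satisfying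
all the linear constraints almost surely. -/
structure Admissible (P : Measure Ω) (T : ℕ) (X₀ : (i : Fin M) → Ω → Fin (S i).nx → ℝ)
    (W : (i : Fin M) → ℕ → Ω → Fin (S i).nx → ℝ)
    (U : (i : Fin M) → ℕ → Ω → Fin (S i).nu → ℝ) : Prop where
  adapted : ∀ i, ∀ t < T, Measurable[info S X₀ W t] (U i t)
  constraints : ∀ᵐ ω ∂P, ∀ t < T, ∀ n, excess S (fun i => U i t ω) n = 0

/-- The expected total cost; the integrand is nonnegative. -/
def expectedCost (P : Measure Ω) (T : ℕ) (X₀ : (i : Fin M) → Ω → Fin (S i).nx → ℝ)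
    (W : (i : Fin M) → ℕ → Ω → Fin (S i).nx → ℝ)
    (U : (i : Fin M) → ℕ → Ω → Fin (S i).nu → ℝ) : ℝ≥0∞ :=
  ∫⁻ ω, ENNReal.ofReal
    (∑ i, (S i).cost T 0 (X₀ i ω) (fun t => U i t ω) (fun t => W i t ω)) ∂P

/-- Social welfare is the negative of the expected total cost. -/
def socialWelfare (P : Measure Ω) (T : ℕ) (X₀ : (i : Fin M) → Ω → Fin (S i).nx → ℝ)
    (W : (i : Fin M) → ℕ → Ω → Fin (S i).nx → ℝ)
    (U : (i : Fin M) → ℕ → Ω → Fin (S i).nu → ℝ) : EReal :=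
  -(expectedCost S P T X₀ W U : EReal)

/-- The state process of the agents under the bid-multiple price iteration; `p₀ ω s t n` are the
initial prices. -/
def schemeState (T : ℕ) (α : ℕ → ℝ) (p₀ : Ω → ℕ → ℕ → Fin N → ℝ)
    (X₀ : (i : Fin M) → Ω → Fin (S i).nx → ℝ) (W : (i : Fin M) → ℕ → Ω → Fin (S i).nx → ℝ)
    (s : ℕ) (ω : Ω) : ∀ i, Fin (S i).nx → ℝ :=
  loopState S T α (p₀ ω) (fun i => X₀ i ω) (fun i t => W i t ω) s

/-- The input `U_i(s) = u^⋆_{i,s}(s)` that the bid-multiple price iteration makes agent `i`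
apply. -/
def schemeInput (T : ℕ) (α : ℕ → ℝ) (p₀ : Ω → ℕ → ℕ → Fin N → ℝ)
    (X₀ : (i : Fin M) → Ω → Fin (S i).nx → ℝ) (W : (i : Fin M) → ℕ → Ω → Fin (S i).nx → ℝ)
    (i : Fin M) (s : ℕ) (ω : Ω) : Fin (S i).nu → ℝ :=
  limitBid S T α s (schemeState S T α p₀ X₀ W s ω) (p₀ ω s) i s

/-- The realized local price `∑_n λ^⋆_{n,s}(s) γ_{i,n}` of agent `i` at time `s`. -/
def schemeLocalPrice (T : ℕ) (α : ℕ → ℝ) (p₀ : Ω → ℕ → ℕ → Fin N → ℝ)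
    (X₀ : (i : Fin M) → Ω → Fin (S i).nx → ℝ) (W : (i : Fin M) → ℕ → Ω → Fin (S i).nx → ℝ)
    (i : Fin M) (s : ℕ) (ω : Ω) : Fin (S i).nu → ℝ :=
  (S i).localPrice (limitPrice S T α s (schemeState S T α p₀ X₀ W s ω) (p₀ ω s) s)

end Stochastic

end BidPrice

end

open BidPrice

/-!
For a fixed time `s` and fixed states, the total cost of the agents over `s ≤ t < T` is a strictly
convex quadratic function of finitely many input coordinates, and the bids in each round are the
minimizer of the Lagrangian. The price update is therefore gradient ascent on the dual function.
The error of the prices stays in the range of the constraint map, where the dual function is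
strongly concave, so every sufficiently short step contracts it and the divergence of `∑ α_k`
drives it to zero (`exists_tendsto_dualAscent`). The limit is an equilibrium of the deterministic
market: optimal bids that satisfy the constraints (`isEquilibrium_limit`). The inputs and the local
prices of an equilibrium are unique, although the prices of the constraints need not be. As the
optimality conditions are linear, they are linear functions of the states, whatever the initial
prices were (`exists_feedback`). This gives causality and square-integrability of the scheme.

Optimality in the stochastic problem rests on a summation by parts (`Agent.costForm_eq`). When
agent `i` deviates from the scheme by `δ`, its net cost changes by a nonnegative quadratic term and
a first-order term. The rest of a plan made at time `t` is again an equilibrium from the state that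
it predicts for time `t + 1` (`IsEquilibrium.tail`), so the plan made at time `t + 1` differs from
it only through the noise at time `t`. Hence the first-order term is
`2 ∑ t, μ_{t+1}(W(t)) · δx(t+1)` with linear maps `μ_{t+1}` (`netCost_eq_of_feedback`). The
deviation `δx(t+1)` of the state is known at time `t` and `W(t)` is centred and independent of that
information, so the expectation vanishes and each agent's input is a best response to the realized
local prices (`integral_netCost_schemeInput_le`). Summed over the agents the payments of an
admissible law are zero, so best responses to common prices have the least expected total cost
(`expectedCost_le_of_bestResponse`).

Gaussianity enters only through independence, square-integrability and vanishing means
(`IsCentredNoise`).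
-/

namespace BidPrice

/-! ### Dual ascent for a strictly convex quadratic program -/

section DualAscent

variable {E : Type*} [NormedAddCommGroup E] [NormedSpace ℝ E] [FiniteDimensional ℝ E]

lemma continuous_apply_self (B : E →ₗ[ℝ] E →ₗ[ℝ] ℝ) : Continuous fun v => B v v := by
  have h : Continuous fun v => LinearMap.toContinuousLinearMap (B v) :=
    (LinearMap.toContinuousLinearMap.toLinearMap ∘ₗ B).continuous_of_finiteDimensional
  exact h.clm_apply continuous_id

/-- Coercivity of a positive definite form in finite dimension. -/
lemma exists_pos_mul_sq_norm_le (B : E →ₗ[ℝ] E →ₗ[ℝ] ℝ) (hB : ∀ v ≠ 0, 0 < B v v) :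
    ∃ c > 0, ∀ v, c * ‖v‖ ^ 2 ≤ B v v := by
  rcases (Metric.sphere (0 : E) 1).eq_empty_or_nonempty with h | h
  · refine ⟨1, one_pos, fun v => ?_⟩
    have hv : v = 0 := by
      by_contra hv
      have : (‖v‖⁻¹ • v) ∈ Metric.sphere (0 : E) 1 := by
        simp [norm_smul, inv_mul_cancel₀ (norm_ne_zero_iff.2 hv)]
      simp [h] at this
    simp [hv]
  · obtain ⟨v₀, hv₀, hmin⟩ := (isCompact_sphere (0 : E) 1).exists_isMinOn h
      (continuous_apply_self B).continuousOn
    have hv₀' : v₀ ≠ 0 := by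
      rintro rfl
      simp at hv₀
    refine ⟨B v₀ v₀, hB _ hv₀', fun v => ?_⟩
    rcases eq_or_ne v 0 with rfl | hv
    · simp
    have hn : ‖v‖ ≠ 0 := norm_ne_zero_iff.2 hv
    have h1 : B v₀ v₀ ≤ B (‖v‖⁻¹ • v) (‖v‖⁻¹ • v) :=
      hmin (show (‖v‖⁻¹ • v) ∈ Metric.sphere (0 : E) 1 by
        simp [norm_smul, inv_mul_cancel₀ hn])
    have h2 : B (‖v‖⁻¹ • v) (‖v‖⁻¹ • v) * ‖v‖ ^ 2 = B v v := by
      simp only [map_smul, LinearMap.smul_apply, smul_eq_mul]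
      field_simp
    rw [← h2]
    gcongr

lemma exists_pos_apply_self_le (A B : E →ₗ[ℝ] E →ₗ[ℝ] ℝ) (hB : ∀ v ≠ 0, 0 < B v v) :
    ∃ K > 0, ∀ v, A v v ≤ K * B v v := by
  obtain ⟨c, hc, hcB⟩ := exists_pos_mul_sq_norm_le B hB
  let A' : E →L[ℝ] E →L[ℝ] ℝ := LinearMap.toContinuousLinearMap
    (LinearMap.toContinuousLinearMap.toLinearMap ∘ₗ A)
  refine ⟨(‖A'‖ + 1) / c, by positivity, fun v => ?_⟩
  calc A v v ≤ ‖A' v v‖ := Real.le_norm_self _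
    _ ≤ ‖A'‖ * ‖v‖ * ‖v‖ := A'.le_opNorm₂ v v
    _ ≤ (‖A'‖ + 1) * ‖v‖ ^ 2 := by nlinarith [sq_nonneg ‖v‖]
    _ = (‖A'‖ + 1) / c * (c * ‖v‖ ^ 2) := by field_simp
    _ ≤ (‖A'‖ + 1) / c * B v v := by gcongr; exact hcB v

/-- Riesz representation for a positive definite form, not assumed symmetric. -/
lemma exists_apply_eq {E : Type*} [AddCommGroup E] [Module ℝ E] [FiniteDimensional ℝ E]
    (B : E →ₗ[ℝ] E →ₗ[ℝ] ℝ) (hB : ∀ v ≠ 0, 0 < B v v) (f : E →ₗ[ℝ] ℝ) :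
    ∃ u, ∀ v, B u v = f v := by
  have hinj : Function.Injective B := by
    rw [← LinearMap.ker_eq_bot, LinearMap.ker_eq_bot']
    intro v hv
    by_contra h
    have := hB v h
    simp [hv] at this
  have hsurj : Function.Surjective B :=
    (LinearMap.injective_iff_surjective_of_finrank_eq_finrank
      (Subspace.dual_finrank_eq (K := ℝ) (V := E)).symm).1 hinj
  obtain ⟨u, hu⟩ := hsurj f
  exact ⟨u, fun v => by rw [hu]⟩

/-- A nonnegative sequence contracted by the factors `1 - c α_k` tends to zero when `∑ α_k`
diverges. The contraction need only hold eventually: initial step sizes may be too large. -/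
lemma tendsto_zero_of_contraction {a α : ℕ → ℝ} {c : ℝ} (hc : 0 < c) (ha : ∀ k, 0 ≤ a k)
    (hα : Tendsto (fun K => ∑ k ∈ Finset.range K, α k) atTop atTop)
    (h : ∀ᶠ k in atTop, a (k + 1) ≤ (1 - c * α k) * a k) : Tendsto a atTop (𝓝 0) := by
  obtain ⟨k₀, hk₀⟩ := eventually_atTop.1 h
  set σ : ℕ → ℝ := fun K => ∑ k ∈ Finset.range K, α k
  -- `a k * exp (c * σ k)` is eventually decreasing
  have hb : ∀ k ≥ k₀, a k * Real.exp (c * σ k) ≤ a k₀ * Real.exp (c * σ k₀) := by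
    intro k hk
    induction k, hk using Nat.le_induction with
    | base => exact le_rfl
    | succ k hk ih =>
      refine le_trans ?_ ih
      have h1 : σ (k + 1) = σ k + α k := Finset.sum_range_succ _ _
      have h2 : a (k + 1) ≤ Real.exp (-(c * α k)) * a k :=
        (hk₀ k hk).trans (mul_le_mul_of_nonneg_right
          (by linarith [Real.add_one_le_exp (-(c * α k))]) (ha k))
      calc a (k + 1) * Real.exp (c * σ (k + 1))
          ≤ Real.exp (-(c * α k)) * a k * Real.exp (c * σ (k + 1)) := by gcongr
        _ = a k * (Real.exp (-(c * α k)) * Real.exp (c * σ (k + 1))) := by ring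
        _ = a k * Real.exp (c * σ k) := by
          rw [← Real.exp_add, h1]
          congr 2
          ring
  have hlim : Tendsto (fun k => a k₀ * Real.exp (c * σ k₀) * Real.exp (-(c * σ k))) atTop
      (𝓝 0) := by
    rw [← mul_zero (a k₀ * Real.exp (c * σ k₀))]
    exact (Real.tendsto_exp_neg_atTop_nhds_zero.comp (hα.const_mul_atTop hc)).const_mul _
  refine tendsto_of_tendsto_of_tendsto_of_le_of_le' tendsto_const_nhds hlim
    (Eventually.of_forall ha) ?_
  filter_upwards [eventually_ge_atTop k₀] with k hk
  rw [Real.exp_neg, ← div_eq_mul_inv, le_div_iff₀ (Real.exp_pos _)]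
  exact hb k hk

lemma dotProduct_self_pos {ι : Type*} [Fintype ι] {v : ι → ℝ} (hv : v ≠ 0) : 0 < v ⬝ᵥ v := by
  simpa using dotProduct_star_self_pos_iff.2 hv

lemma sq_le_dotProduct_self {ι : Type*} [Fintype ι] (v : ι → ℝ) (i : ι) : v i ^ 2 ≤ v ⬝ᵥ v := by
  rw [sq]
  exact Finset.single_le_sum (f := fun i => v i * v i) (fun i _ => mul_self_nonneg _)
    (Finset.mem_univ i)

variable {ι : Type*} [Fintype ι]

/-- Existence of a saddle point of the quadratic program "minimize `B u u / 2 + c u` subject to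
`C u = 0`". The multiplier can be chosen to differ from a prescribed `l₀` by an element of the
range of `C`; this is what singles out the limit of the dual ascent started at `l₀`, as
multipliers are in general not unique. -/
lemma exists_saddle (B : E →ₗ[ℝ] E →ₗ[ℝ] ℝ) (hB : ∀ v ≠ 0, 0 < B v v) (c : E →ₗ[ℝ] ℝ)
    (C : E →ₗ[ℝ] (ι → ℝ)) (l₀ : ι → ℝ) :
    ∃ (u : E) (l : ι → ℝ), (∀ v, B u v + c v + l ⬝ᵥ C v = 0) ∧ C u = 0 ∧
      l₀ - l ∈ LinearMap.range C := by
  obtain ⟨u, hu⟩ := exists_apply_eq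
    (B.domRestrict₁₂ (LinearMap.ker C) (LinearMap.ker C))
    (fun v hv => hB v (by simpa using hv)) (-(c.domRestrict (LinearMap.ker C)))
  obtain ⟨σ, hσ⟩ := C.rangeRestrict.exists_rightInverse_of_surjective C.range_rangeRestrict
  have hσ' : ∀ y : LinearMap.range C, C (σ y) = y := fun y =>
    congrArg Subtype.val (LinearMap.congr_fun hσ y)
  let dot : (ι → ℝ) →ₗ[ℝ] (ι → ℝ) →ₗ[ℝ] ℝ := dotProductBilin ℝ ℝ
  have hdot : ∀ x y, dot x y = x ⬝ᵥ y := fun x y => rfl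
  let f : E →ₗ[ℝ] ℝ := -(B u + c + dot l₀ ∘ₗ C)
  obtain ⟨r, hr⟩ := exists_apply_eq
    (dot.domRestrict₁₂ (LinearMap.range C) (LinearMap.range C))
    (fun v hv => dotProduct_self_pos (by simpa using hv)) (f ∘ₗ σ)
  refine ⟨u, l₀ + r, fun v => ?_, u.2, ?_⟩
  · have h1 := hr (C.rangeRestrict v)
    have h2 : f (v - σ (C.rangeRestrict v)) = 0 := by
      have hker : v - σ (C.rangeRestrict v) ∈ LinearMap.ker C := by
        rw [LinearMap.mem_ker, map_sub, hσ']
        simp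
      have h3 := hu ⟨_, hker⟩
      have h4 : C (v - σ (C.rangeRestrict v)) = 0 := hker
      simp only [LinearMap.domRestrict₁₂_apply, LinearMap.neg_apply,
        LinearMap.domRestrict_apply] at h3
      simp only [f, LinearMap.neg_apply, LinearMap.add_apply, LinearMap.comp_apply, h3, h4]
      simp
    rw [map_sub, sub_eq_zero] at h2
    simp only [LinearMap.domRestrict₁₂_apply, LinearMap.comp_apply, hdot] at h1
    rw [← h2] at h1
    simp only [f, LinearMap.neg_apply, LinearMap.add_apply, LinearMap.comp_apply, hdot] at h1
    rw [add_dotProduct]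
    have h5 : ((C.rangeRestrict v : LinearMap.range C) : ι → ℝ) = C v := rfl
    rw [h5] at h1
    linarith
  · obtain ⟨y, hy⟩ := r.2
    exact ⟨-y, by rw [map_neg, hy]; abel⟩

/-- Dual gradient ascent for "minimize `B u u / 2 + c u` subject to `C u = 0`", with step sizes
tending to zero and of divergent sum, converges to a saddle point. The error `l k - l` of the
multiplier stays in the range of `C`, where the dual function is strongly concave, so each
sufficiently short step is a contraction. -/
theorem exists_tendsto_dualAscent (B : E →ₗ[ℝ] E →ₗ[ℝ] ℝ) (hB : ∀ v ≠ 0, 0 < B v v)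
    (hsymm : ∀ u v, B u v = B v u) (c : E →ₗ[ℝ] ℝ) (C : E →ₗ[ℝ] (ι → ℝ)) {α : ℕ → ℝ}
    (hα_pos : ∀ k, 0 < α k) (hα_lim : Tendsto α atTop (𝓝 0))
    (hα_sum : Tendsto (fun K => ∑ k ∈ Finset.range K, α k) atTop atTop)
    {u : ℕ → E} {l : ℕ → ι → ℝ} (hu : ∀ k v, B (u k) v + c v + l k ⬝ᵥ C v = 0)
    (hl : ∀ k, l (k + 1) = l k + α k • C (u k)) :
    ∃ (u' : E) (l' : ι → ℝ), (∀ v, B u' v + c v + l' ⬝ᵥ C v = 0) ∧ C u' = 0 ∧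
      Tendsto u atTop (𝓝 u') ∧ Tendsto l atTop (𝓝 l') := by
  obtain ⟨u', l', hu', hCu', hl'⟩ := exists_saddle B hB c C (l 0)
  refine ⟨u', l', hu', hCu', ?_⟩
  set d : ℕ → E := fun k => u k - u' with hd
  set e : ℕ → ι → ℝ := fun k => l k - l' with he
  have hde : ∀ k v, B (d k) v = -(e k ⬝ᵥ C v) := fun k v => by
    simp only [hd, he, map_sub, LinearMap.sub_apply, sub_dotProduct]
    linarith [hu k v, hu' v]
  have hCd : ∀ k, C (u k) = C (d k) := fun k => by simp [hd, hCu']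
  have he_succ : ∀ k, e (k + 1) = e k + α k • C (d k) := fun k => by
    simp only [he, hl, hCd]; abel
  have he_mem : ∀ k, e k ∈ LinearMap.range C := by
    intro k
    induction k with
    | zero => exact hl'
    | succ k ih =>
      rw [he_succ]
      exact add_mem ih (Submodule.smul_mem _ _ ⟨_, rfl⟩)
  let dot : (ι → ℝ) →ₗ[ℝ] (ι → ℝ) →ₗ[ℝ] ℝ := dotProductBilin ℝ ℝ
  obtain ⟨K, hK, hKC⟩ := exists_pos_apply_self_le (dot.compl₁₂ C C) B hB
  have hKC' : ∀ v, C v ⬝ᵥ C v ≤ K * B v v := hKC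
  obtain ⟨σ, hσ⟩ := C.rangeRestrict.exists_rightInverse_of_surjective C.range_rangeRestrict
  obtain ⟨K', hK', hKσ⟩ := exists_pos_apply_self_le (B.compl₁₂ σ σ)
    (dot.domRestrict₁₂ (LinearMap.range C) (LinearMap.range C))
    (fun v hv => dotProduct_self_pos (by simpa using hv))
  -- strong concavity of the dual function on the range of `C`
  have hlow : ∀ k, e k ⬝ᵥ e k ≤ K' * B (d k) (d k) := by
    intro k
    set v := σ ⟨e k, he_mem k⟩ with hv
    have hCv : C v = e k := congrArg Subtype.val (LinearMap.congr_fun hσ ⟨e k, he_mem k⟩)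
    have h1 : B v v ≤ K' * (e k ⬝ᵥ e k) := hKσ ⟨e k, he_mem k⟩
    have h2 : B (d k) v = -(e k ⬝ᵥ e k) := by rw [hde, hCv]
    -- in place of the Cauchy-Schwarz inequality for `B (d k) v`
    have h3 : 0 ≤ B (K' • d k + v) (K' • d k + v) := by
      rcases eq_or_ne (K' • d k + v) 0 with h | h
      · simp [h]
      · exact (hB _ h).le
    simp only [map_add, LinearMap.add_apply, map_smul, LinearMap.smul_apply, smul_eq_mul,
      hsymm v (d k), h2] at h3
    have h4 : 0 ≤ K' * (K' * B (d k) (d k) - e k ⬝ᵥ e k) := by nlinarith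
    linarith [nonneg_of_mul_nonneg_right h4 hK']
  -- expand `0 ≤ |K e + C d|²` and use `B d d = -(e · C d)`
  have hupp : ∀ k, B (d k) (d k) ≤ K * (e k ⬝ᵥ e k) := by
    intro k
    have h1 := hKC' (d k)
    have h2 := hde k (d k)
    have h3 : 0 ≤ (K • e k + C (d k)) ⬝ᵥ (K • e k + C (d k)) := by
      simpa using dotProduct_star_self_nonneg (K • e k + C (d k))
    simp only [add_dotProduct, dotProduct_add, smul_dotProduct, dotProduct_smul, smul_eq_mul,
      dotProduct_comm (C (d k)) (e k)] at h3
    have h4 : 0 ≤ K * (K * (e k ⬝ᵥ e k) - B (d k) (d k)) := by nlinarith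
    linarith [nonneg_of_mul_nonneg_right h4 hK]
  have he_lim : Tendsto (fun k => e k ⬝ᵥ e k) atTop (𝓝 0) := by
    refine tendsto_zero_of_contraction (inv_pos.2 hK')
      (fun k => by simpa using dotProduct_star_self_nonneg (e k)) hα_sum ?_
    filter_upwards [hα_lim.eventually_le_const (inv_pos.2 hK)] with k hk
    have h1 : e (k + 1) ⬝ᵥ e (k + 1) =
        e k ⬝ᵥ e k - 2 * α k * B (d k) (d k) + α k ^ 2 * (C (d k) ⬝ᵥ C (d k)) := by
      rw [he_succ, hde]
      simp only [add_dotProduct, dotProduct_add, smul_dotProduct, dotProduct_smul, smul_eq_mul,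
        dotProduct_comm (C (d k)) (e k)]
      ring
    have hBnn : 0 ≤ B (d k) (d k) := by
      rcases eq_or_ne (d k) 0 with h | h
      · simp [h]
      · exact (hB _ h).le
    have h2 : α k * K ≤ 1 := by
      rw [← inv_mul_cancel₀ hK.ne']
      gcongr
    have h3 : α k ^ 2 * (C (d k) ⬝ᵥ C (d k)) ≤ α k * B (d k) (d k) := by
      calc α k ^ 2 * (C (d k) ⬝ᵥ C (d k)) ≤ α k ^ 2 * (K * B (d k) (d k)) := by
            gcongr; exact hKC' _
        _ = α k * ((α k * K) * B (d k) (d k)) := by ring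
        _ ≤ α k * (1 * B (d k) (d k)) := by
            have := (hα_pos k).le
            gcongr
        _ = _ := by ring
    have h4 : K'⁻¹ * (e k ⬝ᵥ e k) ≤ B (d k) (d k) := by
      rw [inv_mul_le_iff₀ hK']
      exact hlow k
    have h5 : α k * (K'⁻¹ * (e k ⬝ᵥ e k)) ≤ α k * B (d k) (d k) :=
      mul_le_mul_of_nonneg_left h4 (hα_pos k).le
    rw [h1]
    nlinarith
  constructor
  · obtain ⟨c₀, hc₀, hc₀B⟩ := exists_pos_mul_sq_norm_le B hB
    rw [tendsto_iff_norm_sub_tendsto_zero]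
    have h1 : Tendsto (fun k => ‖u k - u'‖ ^ 2) atTop (𝓝 0) := by
      refine squeeze_zero (fun k => sq_nonneg _) (g := fun k => c₀⁻¹ * (K * (e k ⬝ᵥ e k)))
        (fun k => ?_) (by simpa using (he_lim.const_mul K).const_mul c₀⁻¹)
      rw [le_inv_mul_iff₀ hc₀]
      exact (hc₀B _).trans (hupp k)
    simpa using h1.sqrt
  · rw [tendsto_pi_nhds]
    intro i
    rw [tendsto_iff_norm_sub_tendsto_zero]
    have h1 : Tendsto (fun k => ‖l k i - l' i‖ ^ 2) atTop (𝓝 0) := by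
      refine squeeze_zero (fun k => sq_nonneg _) (fun k => ?_) he_lim
      rw [Real.norm_eq_abs, sq_abs]
      exact sq_le_dotProduct_self (e k) i
    simpa [Real.sqrt_sq_eq_abs] using h1.sqrt

end DualAscent

/-! ### The linear-quadratic problem of a single agent -/

lemma dotProduct_mulVec_comm {n : ℕ} {Q : Matrix (Fin n) (Fin n) ℝ} (hQ : Q.IsHermitian)
    (x y : Fin n → ℝ) : x ⬝ᵥ (Q *ᵥ y) = y ⬝ᵥ (Q *ᵥ x) := by
  have h : Qᵀ = Q := by simpa [Matrix.IsHermitian, conjTranspose_eq_transpose_of_trivial] using hQ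
  rw [dotProduct_mulVec, ← mulVec_transpose, h, dotProduct_comm]

lemma eq_zero_of_forall_le {b c : ℝ} (hc : 0 ≤ c) (h : ∀ r : ℝ, 0 ≤ r * b + r ^ 2 * c) :
    b = 0 := by
  have h1 := h (-b / (c + 1))
  have h2 : -b / (c + 1) * b + (-b / (c + 1)) ^ 2 * c = -(b / (c + 1)) ^ 2 := by
    field_simp
    ring
  rw [h2] at h1
  have h3 : b / (c + 1) = 0 := by nlinarith [sq_nonneg (b / (c + 1))]
  rcases div_eq_zero_iff.1 h3 with h | h
  · exact h
  · linarith

namespace Agent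

variable {N : ℕ} (a : Agent N)

lemma state_of_le {s t : ℕ} (h : t ≤ s) (x : Fin a.nx → ℝ) (u : ℕ → Fin a.nu → ℝ)
    (w : ℕ → Fin a.nx → ℝ) : a.state s x u w t = x := by
  cases t with
  | zero => rfl
  | succ t => simp [state, Nat.not_le.2 h]

lemma state_succ {s t : ℕ} (h : s ≤ t) (x : Fin a.nx → ℝ) (u : ℕ → Fin a.nu → ℝ)
    (w : ℕ → Fin a.nx → ℝ) :
    a.state s x u w (t + 1) = a.A *ᵥ a.state s x u w t + a.B *ᵥ u t + w t := by
  simp [state, h]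

lemma state_add (s : ℕ) (x x' : Fin a.nx → ℝ) (u u' : ℕ → Fin a.nu → ℝ)
    (w w' : ℕ → Fin a.nx → ℝ) :
    a.state s (x + x') (u + u') (w + w') = a.state s x u w + a.state s x' u' w' := by
  ext1 t
  induction t with
  | zero => rfl
  | succ t ih =>
    by_cases h : s ≤ t
    · rw [Pi.add_apply] at ih
      rw [Pi.add_apply, state_succ _ h, state_succ _ h, state_succ _ h, ih]
      simp only [Pi.add_apply, mulVec_add]
      abel
    · simp [state, h]

lemma state_smul (s : ℕ) (r : ℝ) (x : Fin a.nx → ℝ) (u : ℕ → Fin a.nu → ℝ)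
    (w : ℕ → Fin a.nx → ℝ) :
    a.state s (r • x) (r • u) (r • w) = r • a.state s x u w := by
  ext1 t
  induction t with
  | zero => rfl
  | succ t ih =>
    by_cases h : s ≤ t
    · rw [Pi.smul_apply] at ih
      rw [Pi.smul_apply, state_succ _ h, state_succ _ h, ih]
      simp only [Pi.smul_apply, mulVec_smul, smul_add]
    · simp [state, h]

lemma state_add_input (s : ℕ) (x : Fin a.nx → ℝ) (u δ : ℕ → Fin a.nu → ℝ)
    (w : ℕ → Fin a.nx → ℝ) :
    a.state s x (u + δ) w = a.state s x u w + a.state s 0 δ 0 := by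
  simpa using a.state_add s x 0 u δ w 0

lemma state_congr {s T : ℕ} (x : Fin a.nx → ℝ) {u u' : ℕ → Fin a.nu → ℝ}
    (w : ℕ → Fin a.nx → ℝ) (h : ∀ t ∈ Finset.Ico s T, u t = u' t) {t : ℕ} (ht : t ≤ T) :
    a.state s x u w t = a.state s x u' w t := by
  induction t with
  | zero => rfl
  | succ t ih =>
    by_cases hs : s ≤ t
    · rw [state_succ _ hs, state_succ _ hs, ih (by omega), h t (Finset.mem_Ico.2 ⟨hs, ht⟩)]
    · simp [state, hs]

/-- Restarting the trajectory at time `s + 1` from the state reached there. -/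
lemma state_restart {s t : ℕ} (h : s < t) (x : Fin a.nx → ℝ) (u : ℕ → Fin a.nu → ℝ)
    (w : ℕ → Fin a.nx → ℝ) :
    a.state (s + 1) (a.state s x u w (s + 1)) u w t = a.state s x u w t := by
  induction t, h using Nat.le_induction with
  | base => rw [state_of_le _ le_rfl]
  | succ t ht ih => rw [state_succ _ ht, ih, state_succ _ (by omega)]

/-- The marginal cost `∑_{τ=t}^{T-1} (Aᵀ)^{τ-t} Q z(τ)` of the state at time `t` along the
noise-free trajectory `z` (half the gradient of the remaining cost). -/
def costate (T : ℕ) (z : ℕ → Fin a.nx → ℝ) (t : ℕ) : Fin a.nx → ℝ :=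
  ∑ τ ∈ Finset.Ico t T, (a.Aᵀ ^ (τ - t)) *ᵥ (a.Q *ᵥ z τ)

lemma costate_self (T : ℕ) (z : ℕ → Fin a.nx → ℝ) : a.costate T z T = 0 := by
  simp [costate]

lemma costate_of_lt {T t : ℕ} (h : t < T) (z : ℕ → Fin a.nx → ℝ) :
    a.costate T z t = a.Q *ᵥ z t + a.Aᵀ *ᵥ a.costate T z (t + 1) := by
  rw [costate, Finset.sum_eq_sum_Ico_succ_bot h, costate, mulVec_sum]
  congr 1
  · simp
  · refine Finset.sum_congr rfl fun τ hτ => ?_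
    have : τ - t = τ - (t + 1) + 1 := by have := (Finset.mem_Ico.1 hτ).1; omega
    rw [this, pow_succ', ← mulVec_mulVec]

lemma costate_congr {T t : ℕ} {z z' : ℕ → Fin a.nx → ℝ} (h : ∀ τ ∈ Finset.Ico t T, z τ = z' τ) :
    a.costate T z t = a.costate T z' t :=
  Finset.sum_congr rfl fun τ hτ => by rw [h τ hτ]

lemma costate_add (T : ℕ) (z z' : ℕ → Fin a.nx → ℝ) (t : ℕ) :
    a.costate T (z + z') t = a.costate T z t + a.costate T z' t := by
  simp [costate, mulVec_add, Finset.sum_add_distrib]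

lemma costate_smul (T : ℕ) (r : ℝ) (z : ℕ → Fin a.nx → ℝ) (t : ℕ) :
    a.costate T (r • z) t = r • a.costate T z t := by
  simp [costate, mulVec_smul, Finset.smul_sum]

/-- Half the derivative of the cost, along the trajectory `z` with inputs `u`, in the direction
of the input perturbation `δ`. -/
def costForm (T s : ℕ) (z : ℕ → Fin a.nx → ℝ) (u δ : ℕ → Fin a.nu → ℝ) : ℝ :=
  ∑ t ∈ Finset.Ico s T, (z t ⬝ᵥ (a.Q *ᵥ a.state s 0 δ 0 t) + u t ⬝ᵥ (a.R *ᵥ δ t))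

lemma cost_add_input (T s : ℕ) (x : Fin a.nx → ℝ) (u δ : ℕ → Fin a.nu → ℝ)
    (w : ℕ → Fin a.nx → ℝ) :
    a.cost T s x (u + δ) w =
      a.cost T s x u w + 2 * a.costForm T s (a.state s x u w) u δ + a.cost T s 0 δ 0 := by
  simp only [cost, costForm, Finset.mul_sum, ← Finset.sum_add_distrib]
  refine Finset.sum_congr rfl fun t _ => ?_
  rw [state_add_input]
  simp only [Pi.add_apply, mulVec_add, dotProduct_add, add_dotProduct,
    dotProduct_mulVec_comm a.Q_psd.1 (a.state s 0 δ 0 t) (a.state s x u w t),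
    dotProduct_mulVec_comm a.R_pd.1 (δ t) (u t)]
  ring

lemma netCost_add_input (T s : ℕ) (x : Fin a.nx → ℝ) (π u δ : ℕ → Fin a.nu → ℝ)
    (w : ℕ → Fin a.nx → ℝ) :
    a.netCost T s x π (u + δ) w = a.netCost T s x π u w +
      (2 * a.costForm T s (a.state s x u w) u δ + ∑ t ∈ Finset.Ico s T, π t ⬝ᵥ δ t) +
        a.cost T s 0 δ 0 := by
  simp only [netCost, cost_add_input, Pi.add_apply, dotProduct_add, Finset.sum_add_distrib]
  ring

lemma dotProduct_Q_nonneg (x : Fin a.nx → ℝ) : 0 ≤ x ⬝ᵥ (a.Q *ᵥ x) := by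
  simpa using a.Q_psd.dotProduct_mulVec_nonneg x

lemma dotProduct_R_nonneg (u : Fin a.nu → ℝ) : 0 ≤ u ⬝ᵥ (a.R *ᵥ u) := by
  simpa using a.R_pd.posSemidef.dotProduct_mulVec_nonneg u

lemma dotProduct_R_pos {u : Fin a.nu → ℝ} (hu : u ≠ 0) : 0 < u ⬝ᵥ (a.R *ᵥ u) := by
  simpa using a.R_pd.dotProduct_mulVec_pos hu

lemma cost_nonneg (T s : ℕ) (x : Fin a.nx → ℝ) (u : ℕ → Fin a.nu → ℝ) (w : ℕ → Fin a.nx → ℝ) :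
    0 ≤ a.cost T s x u w :=
  Finset.sum_nonneg fun _ _ => add_nonneg (a.dotProduct_Q_nonneg _) (a.dotProduct_R_nonneg _)

lemma dotProduct_R_le_cost {T s t : ℕ} (ht : t ∈ Finset.Ico s T) (x : Fin a.nx → ℝ)
    (u : ℕ → Fin a.nu → ℝ) (w : ℕ → Fin a.nx → ℝ) :
    u t ⬝ᵥ (a.R *ᵥ u t) ≤ a.cost T s x u w :=
  (le_add_of_nonneg_left (a.dotProduct_Q_nonneg _)).trans
    (Finset.single_le_sum (f := fun t => a.state s x u w t ⬝ᵥ (a.Q *ᵥ a.state s x u w t) +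
      u t ⬝ᵥ (a.R *ᵥ u t))
      (fun _ _ => add_nonneg (a.dotProduct_Q_nonneg _) (a.dotProduct_R_nonneg _)) ht)

lemma eq_zero_of_cost_le_zero {T s : ℕ} {x : Fin a.nx → ℝ} {u : ℕ → Fin a.nu → ℝ}
    {w : ℕ → Fin a.nx → ℝ} (h : a.cost T s x u w ≤ 0) {t : ℕ} (ht : t ∈ Finset.Ico s T) :
    u t = 0 := by
  by_contra hu
  exact absurd (a.dotProduct_R_pos hu) (not_lt.2 ((a.dotProduct_R_le_cost ht x u w).trans h))

/-- Summation by parts for the derivative of the cost. Here `μ (t + 1)` and `φ t` are two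
values of the costate at time `t + 1`: they agree along a deterministic optimal plan, and when
the plan is revised at time `t + 1` their difference is the effect of the noise at time `t`. -/
lemma costForm_eq {T s : ℕ} (hs : s ≤ T) {z μ φ : ℕ → Fin a.nx → ℝ}
    (hμ : ∀ t ∈ Finset.Ico s T, μ t = a.Q *ᵥ z t + a.Aᵀ *ᵥ φ t) (hT : μ T = 0)
    (u δ : ℕ → Fin a.nu → ℝ) :
    a.costForm T s z u δ =
      ∑ t ∈ Finset.Ico s T, (a.R *ᵥ u t + a.Bᵀ *ᵥ φ t) ⬝ᵥ δ t +
        ∑ t ∈ Finset.Ico s T, (μ (t + 1) - φ t) ⬝ᵥ a.state s 0 δ 0 (t + 1) := by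
  have htel : ∑ t ∈ Finset.Ico s T, (μ (t + 1) ⬝ᵥ a.state s 0 δ 0 (t + 1) -
      μ t ⬝ᵥ a.state s 0 δ 0 t) = 0 := by
    rw [Finset.sum_Ico_sub (fun t => μ t ⬝ᵥ a.state s 0 δ 0 t) hs, hT, state_of_le _ le_rfl]
    simp
  rw [costForm, ← Finset.sum_add_distrib, ← sub_eq_zero, ← neg_eq_zero, ← htel,
    ← Finset.sum_sub_distrib, ← Finset.sum_neg_distrib]
  refine Finset.sum_congr rfl fun t ht => ?_
  have h1 : (a.Aᵀ *ᵥ φ t) ⬝ᵥ a.state s 0 δ 0 t = φ t ⬝ᵥ (a.A *ᵥ a.state s 0 δ 0 t) := by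
    rw [mulVec_transpose, dotProduct_mulVec]
  have h2 : (a.Bᵀ *ᵥ φ t) ⬝ᵥ δ t = φ t ⬝ᵥ (a.B *ᵥ δ t) := by
    rw [mulVec_transpose, dotProduct_mulVec]
  rw [hμ t ht, sub_dotProduct, add_dotProduct, add_dotProduct, h1, h2,
    dotProduct_comm (a.Q *ᵥ z t), dotProduct_comm (a.R *ᵥ u t),
    dotProduct_mulVec_comm a.Q_psd.1 (z t), ← dotProduct_mulVec_comm a.R_pd.1 (u t) (δ t),
    dotProduct_comm (u t), state_succ _ (Finset.mem_Ico.1 ht).1]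
  simp only [dotProduct_add, Pi.zero_apply, dotProduct_zero]
  ring

/-- The gradient, with respect to the input at time `t`, of the net cost of the noise-free
problem at local prices `π`. -/
def gradient (T s : ℕ) (x : Fin a.nx → ℝ) (π u : ℕ → Fin a.nu → ℝ) (t : ℕ) : Fin a.nu → ℝ :=
  (2 : ℝ) • (a.R *ᵥ u t + a.Bᵀ *ᵥ a.costate T (a.state s x u 0) (t + 1)) + π t

lemma costForm_add_payment (T s : ℕ) (x : Fin a.nx → ℝ) (π u δ : ℕ → Fin a.nu → ℝ) :
    2 * a.costForm T s (a.state s x u 0) u δ + ∑ t ∈ Finset.Ico s T, π t ⬝ᵥ δ t =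
      ∑ t ∈ Finset.Ico s T, a.gradient T s x π u t ⬝ᵥ δ t := by
  rcases le_or_gt s T with hs | hs
  · rw [a.costForm_eq hs (μ := a.costate T (a.state s x u 0))
      (φ := fun t => a.costate T (a.state s x u 0) (t + 1))
      (fun t ht => a.costate_of_lt (Finset.mem_Ico.1 ht).2 _) (a.costate_self _ _)]
    simp [gradient, add_dotProduct, smul_dotProduct, Finset.sum_add_distrib, Finset.mul_sum,
      mul_add]
  · simp [costForm, Finset.Ico_eq_empty_of_le hs.le]

lemma gradient_congr {T s : ℕ} {x : Fin a.nx → ℝ} {π π' u u' : ℕ → Fin a.nu → ℝ}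
    (hπ : ∀ t ∈ Finset.Ico s T, π t = π' t) (hu : ∀ t ∈ Finset.Ico s T, u t = u' t)
    {t : ℕ} (ht : t ∈ Finset.Ico s T) :
    a.gradient T s x π u t = a.gradient T s x π' u' t := by
  rw [gradient, gradient, hπ t ht, hu t ht, a.costate_congr fun τ hτ =>
    a.state_congr x 0 hu (Finset.mem_Ico.1 hτ).2.le]

lemma gradient_add (T s : ℕ) (x x' : Fin a.nx → ℝ) (π π' u u' : ℕ → Fin a.nu → ℝ) (t : ℕ) :
    a.gradient T s (x + x') (π + π') (u + u') t =
      a.gradient T s x π u t + a.gradient T s x' π' u' t := by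
  have h := a.state_add s x x' u u' 0 0
  rw [add_zero] at h
  rw [gradient, h, costate_add]
  simp only [gradient, Pi.add_apply, mulVec_add, smul_add]
  abel

lemma gradient_smul (T s : ℕ) (r : ℝ) (x : Fin a.nx → ℝ) (π u : ℕ → Fin a.nu → ℝ) (t : ℕ) :
    a.gradient T s (r • x) (r • π) (r • u) t = r • a.gradient T s x π u t := by
  have h := a.state_smul s r x u 0
  rw [smul_zero] at h
  rw [gradient, h, costate_smul]
  simp only [gradient, Pi.smul_apply, mulVec_smul, smul_add, smul_comm r (2 : ℝ)]

/-- The first-order optimality condition, necessary and sufficient by convexity. -/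
lemma isOptimalBid_iff {T s : ℕ} {x : Fin a.nx → ℝ} {p : ℕ → Fin N → ℝ}
    {u : ℕ → Fin a.nu → ℝ} :
    a.IsOptimalBid T s x p u ↔
      ∀ t ∈ Finset.Ico s T, a.gradient T s x (fun t => a.localPrice (p t)) u t = 0 := by
  constructor
  · intro h
    set g := a.gradient T s x (fun t => a.localPrice (p t)) u with hg
    have h1 : ∑ t ∈ Finset.Ico s T, g t ⬝ᵥ g t = 0 := by
      refine eq_zero_of_forall_le (a.cost_nonneg T s 0 g 0) fun r => ?_
      have h2 := h (u + r • g)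
      rw [netCost_add_input, costForm_add_payment] at h2
      have h3 : a.cost T s 0 (r • g) 0 = r ^ 2 * a.cost T s 0 g 0 := by
        have h := a.state_smul s r 0 g 0
        rw [smul_zero, smul_zero] at h
        simp only [cost, h, Finset.mul_sum, Pi.smul_apply, mulVec_smul, smul_dotProduct,
          dotProduct_smul, smul_eq_mul]
        exact Finset.sum_congr rfl fun t _ => by ring
      have h4 : ∑ t ∈ Finset.Ico s T, g t ⬝ᵥ (r • g) t = r * ∑ t ∈ Finset.Ico s T, g t ⬝ᵥ g t := by
        simp [Finset.mul_sum]
      rw [h3, ← hg, h4] at h2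
      linarith
    rw [Finset.sum_eq_zero_iff_of_nonneg
      (fun t _ => by simpa using dotProduct_star_self_nonneg (g t))] at h1
    exact fun t ht => dotProduct_self_eq_zero.1 (h1 t ht)
  · intro h v
    have h1 := a.netCost_add_input T s x (fun t => a.localPrice (p t)) u (v - u) 0
    rw [costForm_add_payment, Finset.sum_eq_zero (fun t ht => by rw [h t ht, zero_dotProduct]),
      add_sub_cancel] at h1
    linarith [a.cost_nonneg T s 0 (v - u) 0]

lemma IsOptimalBid.unique {T s : ℕ} {x : Fin a.nx → ℝ} {p : ℕ → Fin N → ℝ}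
    {u v : ℕ → Fin a.nu → ℝ} (hu : a.IsOptimalBid T s x p u) (hv : a.IsOptimalBid T s x p v)
    {t : ℕ} (ht : t ∈ Finset.Ico s T) : v t = u t := by
  have h1 := a.netCost_add_input T s x (fun t => a.localPrice (p t)) u (v - u) 0
  rw [costForm_add_payment, Finset.sum_eq_zero
    (fun t ht => by rw [a.isOptimalBid_iff.1 hu t ht, zero_dotProduct]), add_sub_cancel] at h1
  have h2 : a.cost T s 0 (v - u) 0 ≤ 0 := by linarith [hv u]
  simpa [sub_eq_zero] using a.eq_zero_of_cost_le_zero h2 ht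

/-- Extension by zero of an input sequence over the horizon `s ≤ t < T`. -/
def extend (T s : ℕ) : (Finset.Ico s T → Fin a.nu → ℝ) →ₗ[ℝ] (ℕ → Fin a.nu → ℝ) where
  toFun u t := if h : t ∈ Finset.Ico s T then u ⟨t, h⟩ else 0
  map_add' u v := by
    ext1 t
    rw [Pi.add_apply]
    split_ifs <;> simp
  map_smul' r u := by
    ext1 t
    rw [Pi.smul_apply]
    split_ifs <;> simp

lemma extend_apply {T s t : ℕ} (ht : t ∈ Finset.Ico s T) (u : Finset.Ico s T → Fin a.nu → ℝ) :
    a.extend T s u t = u ⟨t, ht⟩ := by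
  change (if h : t ∈ Finset.Ico s T then u ⟨t, h⟩ else 0) = _
  rw [dif_pos ht]

lemma costForm_add_left (T s : ℕ) (z z' : ℕ → Fin a.nx → ℝ) (u u' δ : ℕ → Fin a.nu → ℝ) :
    a.costForm T s (z + z') (u + u') δ = a.costForm T s z u δ + a.costForm T s z' u' δ := by
  simp only [costForm, Pi.add_apply, add_dotProduct, ← Finset.sum_add_distrib]
  exact Finset.sum_congr rfl fun t _ => by ring

lemma costForm_smul_left (T s : ℕ) (r : ℝ) (z : ℕ → Fin a.nx → ℝ) (u δ : ℕ → Fin a.nu → ℝ) :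
    a.costForm T s (r • z) (r • u) δ = r * a.costForm T s z u δ := by
  simp only [costForm, Pi.smul_apply, smul_dotProduct, Finset.mul_sum, smul_eq_mul, mul_add]

lemma costForm_add_right (T s : ℕ) (z : ℕ → Fin a.nx → ℝ) (u δ δ' : ℕ → Fin a.nu → ℝ) :
    a.costForm T s z u (δ + δ') = a.costForm T s z u δ + a.costForm T s z u δ' := by
  simp only [costForm, state_add_input, Pi.add_apply, mulVec_add, dotProduct_add,
    ← Finset.sum_add_distrib]
  exact Finset.sum_congr rfl fun t _ => by ring

lemma costForm_smul_right (T s : ℕ) (r : ℝ) (z : ℕ → Fin a.nx → ℝ) (u δ : ℕ → Fin a.nu → ℝ) :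
    a.costForm T s z u (r • δ) = r * a.costForm T s z u δ := by
  have h := a.state_smul s r 0 δ 0
  rw [smul_zero, smul_zero] at h
  simp only [costForm, h, Pi.smul_apply, mulVec_smul, dotProduct_smul, smul_eq_mul,
    Finset.mul_sum, mul_add]

/-- The Hessian of the cost on the space of input sequences over the horizon. -/
def hessian (T s : ℕ) : (Finset.Ico s T → Fin a.nu → ℝ) →ₗ[ℝ]
    (Finset.Ico s T → Fin a.nu → ℝ) →ₗ[ℝ] ℝ :=
  LinearMap.mk₂ ℝ (fun u v => 2 * a.costForm T s (a.state s 0 (a.extend T s u) 0)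
      (a.extend T s u) (a.extend T s v))
    (fun u u' v => by rw [map_add, state_add_input, costForm_add_left, mul_add])
    (fun r u v => by
      have h := a.state_smul s r 0 (a.extend T s u) 0
      rw [smul_zero, smul_zero] at h
      rw [map_smul, h, costForm_smul_left, smul_eq_mul]
      ring)
    (fun u v v' => by rw [map_add, costForm_add_right, mul_add])
    (fun r u v => by rw [map_smul, costForm_smul_right, smul_eq_mul]; ring)

/-- The derivative, at zero input, of the cost on the space of input sequences. -/
def slope (T s : ℕ) (x : Fin a.nx → ℝ) : (Finset.Ico s T → Fin a.nu → ℝ) →ₗ[ℝ] ℝ where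
  toFun v := 2 * a.costForm T s (a.state s x 0 0) 0 (a.extend T s v)
  map_add' v v' := by rw [map_add, costForm_add_right, mul_add]
  map_smul' r v := by
    rw [map_smul, costForm_smul_right, RingHom.id_apply, smul_eq_mul]
    ring

lemma hessian_add_slope (T s : ℕ) (x : Fin a.nx → ℝ) (u v : Finset.Ico s T → Fin a.nu → ℝ) :
    a.hessian T s u v + a.slope T s x v =
      2 * a.costForm T s (a.state s x (a.extend T s u) 0) (a.extend T s u) (a.extend T s v) := by
  have h := a.state_add_input s x 0 (a.extend T s u) 0
  rw [zero_add] at h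
  rw [h, ← zero_add (a.extend T s u), costForm_add_left, zero_add]
  simp only [hessian, slope, LinearMap.mk₂_apply, LinearMap.coe_mk, AddHom.coe_mk]
  ring

lemma hessian_symm (T s : ℕ) (u v : Finset.Ico s T → Fin a.nu → ℝ) :
    a.hessian T s u v = a.hessian T s v u := by
  simp only [hessian, LinearMap.mk₂_apply, costForm]
  congr 1
  refine Finset.sum_congr rfl fun t _ => ?_
  rw [dotProduct_mulVec_comm a.Q_psd.1, dotProduct_mulVec_comm a.R_pd.1]

lemma hessian_self (T s : ℕ) (u : Finset.Ico s T → Fin a.nu → ℝ) :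
    a.hessian T s u u = 2 * a.cost T s 0 (a.extend T s u) 0 := rfl

lemma hessian_self_nonneg (T s : ℕ) (u : Finset.Ico s T → Fin a.nu → ℝ) :
    0 ≤ a.hessian T s u u := by
  rw [hessian_self]
  exact mul_nonneg zero_le_two (a.cost_nonneg _ _ _ _ _)

lemma hessian_self_pos (T s : ℕ) {u : Finset.Ico s T → Fin a.nu → ℝ} (hu : u ≠ 0) :
    0 < a.hessian T s u u := by
  refine lt_of_le_of_ne (a.hessian_self_nonneg T s u) fun h => hu ?_
  rw [hessian_self] at h
  ext1 t
  rw [← a.extend_apply t.2 u]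
  exact a.eq_zero_of_cost_le_zero (by linarith) t.2

lemma sum_extend {T s : ℕ} (π : ℕ → Fin a.nu → ℝ) (v : Finset.Ico s T → Fin a.nu → ℝ) :
    ∑ t ∈ Finset.Ico s T, π t ⬝ᵥ a.extend T s v t = ∑ t : Finset.Ico s T, π t ⬝ᵥ v t := by
  rw [← Finset.sum_coe_sort]
  exact Finset.sum_congr rfl fun t _ => by rw [a.extend_apply t.2]

/-- Only the inputs over the horizon matter, so the agent's problem is finite-dimensional and
strictly convex. -/
lemma exists_isOptimalBid (T s : ℕ) (x : Fin a.nx → ℝ) (p : ℕ → Fin N → ℝ) :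
    ∃ u, a.IsOptimalBid T s x p u := by
  let pay : (Finset.Ico s T → Fin a.nu → ℝ) →ₗ[ℝ] ℝ :=
    { toFun := fun v => ∑ t : Finset.Ico s T, a.localPrice (p t) ⬝ᵥ v t
      map_add' := fun v v' => by simp [dotProduct_add, Finset.sum_add_distrib]
      map_smul' := fun r v => by simp [Finset.mul_sum] }
  obtain ⟨u, hu⟩ := exists_apply_eq (a.hessian T s) (fun v hv => a.hessian_self_pos T s hv)
    (-(a.slope T s x + pay))
  -- the first-order condition, tested against the gradient itself, makes the gradient vanish
  refine ⟨a.extend T s u, a.isOptimalBid_iff.2 ?_⟩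
  set g := a.gradient T s x (fun t => a.localPrice (p t)) (a.extend T s u) with hg
  have h1 := hu (fun t => g t)
  have h2 := a.costForm_add_payment T s x (fun t => a.localPrice (p t)) (a.extend T s u)
    (a.extend T s (fun t => g t))
  rw [← hessian_add_slope, sum_extend, sum_extend, h1] at h2
  have h3 : pay (fun t => g t) = ∑ t : Finset.Ico s T, a.localPrice (p t) ⬝ᵥ g t := rfl
  rw [LinearMap.neg_apply, LinearMap.add_apply, h3, ← hg] at h2
  have h4 : ∑ t : Finset.Ico s T, g t ⬝ᵥ g t = 0 := by rw [← h2]; ring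
  rw [Finset.sum_eq_zero_iff_of_nonneg
    (fun t _ => by simpa using dotProduct_star_self_nonneg (g t))] at h4
  exact fun t ht => dotProduct_self_eq_zero.1 (h4 ⟨t, ht⟩ (Finset.mem_univ _))

lemma isOptimalBid_bid (T s : ℕ) (x : Fin a.nx → ℝ) (p : ℕ → Fin N → ℝ) :
    a.IsOptimalBid T s x p (a.bid T s x p) :=
  Classical.epsilon_spec (a.exists_isOptimalBid T s x p)

end Agent

/-! ### Equilibria of the deterministic market -/

section Market

variable {M N : ℕ} (S : Fin M → Agent N)

lemma sum_localPrice_dotProduct (p : Fin N → ℝ) (u : ∀ i, Fin (S i).nu → ℝ) :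
    ∑ i, (S i).localPrice p ⬝ᵥ u i = ∑ n, p n * excess S u n := by
  simp only [Agent.localPrice, excess, sum_dotProduct, smul_dotProduct, smul_eq_mul,
    Finset.mul_sum]
  exact Finset.sum_comm

lemma sum_payments (T s : ℕ) (p : ℕ → Fin N → ℝ) (u : ∀ i, ℕ → Fin (S i).nu → ℝ) :
    ∑ i, ∑ t ∈ Finset.Ico s T, (S i).localPrice (p t) ⬝ᵥ u i t =
      ∑ t ∈ Finset.Ico s T, ∑ n, p t n * excess S (fun i => u i t) n := by
  rw [Finset.sum_comm]
  exact Finset.sum_congr rfl fun t _ => sum_localPrice_dotProduct S (p t) fun i => u i t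

lemma sum_netCost (T s : ℕ) (x : ∀ i, Fin (S i).nx → ℝ) (p : ℕ → Fin N → ℝ)
    (u : ∀ i, ℕ → Fin (S i).nu → ℝ) (w : ∀ i, ℕ → Fin (S i).nx → ℝ) :
    ∑ i, (S i).netCost T s (x i) (fun t => (S i).localPrice (p t)) (u i) (w i) =
      ∑ i, (S i).cost T s (x i) (u i) (w i) +
        ∑ t ∈ Finset.Ico s T, ∑ n, p t n * excess S (fun i => u i t) n := by
  simp only [Agent.netCost, Finset.sum_add_distrib, sum_payments]

/-- A competitive equilibrium of the noise-free market over `s ≤ t < T` from the states `x`: the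
inputs `u` are optimal responses to the prices `p` and clear the market. -/
structure IsEquilibrium (T s : ℕ) (x : ∀ i, Fin (S i).nx → ℝ)
    (u : ∀ i, ℕ → Fin (S i).nu → ℝ) (p : ℕ → Fin N → ℝ) : Prop where
  optimal : ∀ i, (S i).IsOptimalBid T s (x i) p (u i)
  clears : ∀ t ∈ Finset.Ico s T, ∀ n, excess S (fun i => u i t) n = 0

namespace IsEquilibrium

variable {S} {T s : ℕ} {x : ∀ i, Fin (S i).nx → ℝ} {u u' : ∀ i, ℕ → Fin (S i).nu → ℝ}
  {p p' : ℕ → Fin N → ℝ}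

lemma congr (h : IsEquilibrium S T s x u p) (hu : ∀ t ∈ Finset.Ico s T, ∀ i, u i t = u' i t)
    (hp : ∀ t ∈ Finset.Ico s T, ∀ n, p t n = p' t n) : IsEquilibrium S T s x u' p' where
  optimal i := by
    have h1 := h.optimal i
    rw [Agent.isOptimalBid_iff] at h1 ⊢
    intro t ht
    rw [← h1 t ht]
    refine ((S i).gradient_congr (fun t ht => ?_) (fun t ht => hu t ht i) ht).symm
    rw [show p t = p' t from funext (hp t ht)]
  clears t ht n := by
    rw [← h.clears t ht n]
    congr 1
    ext1 i
    exact (hu t ht i).symm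

lemma sum_netCost_eq (h : ∀ t ∈ Finset.Ico s T, ∀ n, excess S (fun i => u i t) n = 0)
    (p : ℕ → Fin N → ℝ) :
    ∑ i, (S i).netCost T s (x i) (fun t => (S i).localPrice (p t)) (u i) 0 =
      ∑ i, (S i).cost T s (x i) (u i) 0 := by
  have h1 := sum_netCost S T s x p u 0
  rw [Finset.sum_eq_zero (s := Finset.Ico s T)
    (fun t ht => Finset.sum_eq_zero fun n _ => by rw [h t ht n, mul_zero]), add_zero] at h1
  exact h1

/-- Equilibrium inputs are unique, because the total cost is strictly convex. -/
lemma input_unique (h : IsEquilibrium S T s x u p) (h' : IsEquilibrium S T s x u' p')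
    {t : ℕ} (ht : t ∈ Finset.Ico s T) (i : Fin M) : u' i t = u i t := by
  have h1 : ∑ i, (S i).cost T s (x i) (u' i) 0 ≤ ∑ i, (S i).cost T s (x i) (u i) 0 := by
    rw [← sum_netCost_eq h.clears p', ← sum_netCost_eq h'.clears p']
    exact Finset.sum_le_sum fun i _ => h'.optimal i (u i)
  have h2 : ∑ i, (S i).cost T s (x i) (u' i) 0 = ∑ i, (S i).cost T s (x i) (u i) 0 +
      ∑ i, (S i).cost T s 0 (u' i - u i) 0 := by
    rw [← sum_netCost_eq h.clears p, ← sum_netCost_eq h'.clears p, ← Finset.sum_add_distrib]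
    refine Finset.sum_congr rfl fun i _ => ?_
    have h3 := (S i).netCost_add_input T s (x i) (fun t => (S i).localPrice (p t)) (u i)
      (u' i - u i) 0
    rw [Agent.costForm_add_payment, Finset.sum_eq_zero (fun t ht => by
      rw [(S i).isOptimalBid_iff.1 (h.optimal i) t ht, zero_dotProduct]), add_sub_cancel] at h3
    rw [h3, add_zero]
  have h3 : (S i).cost T s 0 (u' i - u i) 0 ≤ ∑ i, (S i).cost T s 0 (u' i - u i) 0 :=
    Finset.single_le_sum (f := fun i => (S i).cost T s 0 (u' i - u i) 0)
      (fun i _ => (S i).cost_nonneg _ _ _ _ _) (Finset.mem_univ i)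
  simpa [sub_eq_zero] using (S i).eq_zero_of_cost_le_zero (h3.trans (by linarith)) ht

/-- Equilibrium prices need not be unique, but the local prices are: they are determined by the
equilibrium inputs through the first-order condition. -/
lemma localPrice_unique (h : IsEquilibrium S T s x u p) (h' : IsEquilibrium S T s x u' p')
    {t : ℕ} (ht : t ∈ Finset.Ico s T) (i : Fin M) :
    (S i).localPrice (p' t) = (S i).localPrice (p t) := by
  have h1 := (S i).isOptimalBid_iff.1 (h.optimal i) t ht
  have h2 := (S i).isOptimalBid_iff.1 (h'.optimal i) t ht
  rw [(S i).gradient_congr (fun _ _ => rfl) (fun t ht => h.input_unique h' ht i) ht] at h2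
  rw [← h1] at h2
  exact add_left_cancel h2

/-- Consistency over time: from the state reached at time `s + 1`, the rest of an equilibrium is
an equilibrium. -/
lemma tail (h : IsEquilibrium S T s x u p) :
    IsEquilibrium S T (s + 1) (fun i => (S i).A *ᵥ x i + (S i).B *ᵥ u i s) u p where
  optimal i := by
    have h1 := h.optimal i
    rw [Agent.isOptimalBid_iff] at h1 ⊢
    intro t ht
    have ht' := Finset.mem_Ico.1 ht
    rw [← h1 t (Finset.mem_Ico.2 ⟨by omega, ht'.2⟩), Agent.gradient, Agent.gradient]
    congr 4
    refine (S i).costate_congr fun τ hτ => ?_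
    have hτ' := Finset.mem_Ico.1 hτ
    rw [← (S i).state_restart (show s < τ by omega) (x i), (S i).state_succ le_rfl,
      (S i).state_of_le le_rfl, Pi.zero_apply, add_zero]
  clears t ht := h.clears t (Finset.Ico_subset_Ico_left (Nat.le_succ s) ht)

/-- Equilibrium prices solve the dual problem: the total cost of the equilibrium inputs is an
upper bound of the dual function, attained at the equilibrium prices. -/
lemma dualFunction_le (h : IsEquilibrium S T s x u p) (q : ℕ → Fin N → ℝ) :
    dualFunction S T s x q ≤ dualFunction S T s x p := by
  have h1 : dualFunction S T s x q ≤ ((∑ i, (S i).cost T s (x i) (u i) 0 : ℝ) : EReal) := by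
    refine (iInf_le _ u).trans (le_of_eq ?_)
    have h1 : ∑ i, (S i).netCost T s (x i) (fun t => (S i).localPrice (q t)) (u i) 0 = _ :=
      sum_netCost S T s x q u 0
    rw [sum_netCost_eq h.clears q] at h1
    exact congrArg _ h1.symm
  refine h1.trans (le_iInf fun v => EReal.coe_le_coe_iff.2 ?_)
  have h2 := sum_netCost S T s x p v 0
  rw [← sum_netCost_eq h.clears p]
  exact (Finset.sum_le_sum fun i _ => h.optimal i (v i)).trans_eq h2

lemma add {x' : ∀ i, Fin (S i).nx → ℝ} (h : IsEquilibrium S T s x u p)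
    (h' : IsEquilibrium S T s x' u' p') : IsEquilibrium S T s (x + x') (u + u') (p + p') where
  optimal i := by
    rw [Agent.isOptimalBid_iff]
    intro t ht
    have h1 := (S i).gradient_add T s (x i) (x' i) (fun t => (S i).localPrice (p t))
      (fun t => (S i).localPrice (p' t)) (u i) (u' i) t
    rw [(S i).isOptimalBid_iff.1 (h.optimal i) t ht,
      (S i).isOptimalBid_iff.1 (h'.optimal i) t ht, add_zero] at h1
    rw [← h1]
    congr 1
    ext1 t
    simp [Agent.localPrice, add_smul, Finset.sum_add_distrib]
  clears t ht n := by
    have h1 := h.clears t ht n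
    have h2 := h'.clears t ht n
    simp only [excess, Pi.add_apply, dotProduct_add, Finset.sum_add_distrib] at h1 h2 ⊢
    rw [h1, h2, add_zero]

lemma smul (r : ℝ) (h : IsEquilibrium S T s x u p) :
    IsEquilibrium S T s (r • x) (r • u) (r • p) where
  optimal i := by
    rw [Agent.isOptimalBid_iff]
    intro t ht
    have h1 := (S i).gradient_smul T s r (x i) (fun t => (S i).localPrice (p t)) (u i) t
    rw [(S i).isOptimalBid_iff.1 (h.optimal i) t ht, smul_zero] at h1
    rw [← h1]
    congr 1
    ext1 t
    simp [Agent.localPrice, mul_smul, Finset.smul_sum]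
  clears t ht n := by
    have h1 := h.clears t ht n
    simp only [excess, Pi.smul_apply, dotProduct_smul, ← Finset.smul_sum] at h1 ⊢
    rw [h1, smul_zero]

end IsEquilibrium

/-- The Hessian of the total cost of the agents. -/
def totalHessian (T s : ℕ) : (∀ i, Finset.Ico s T → Fin (S i).nu → ℝ) →ₗ[ℝ]
    (∀ i, Finset.Ico s T → Fin (S i).nu → ℝ) →ₗ[ℝ] ℝ :=
  ∑ i, ((S i).hessian T s).compl₁₂ (LinearMap.proj i) (LinearMap.proj i)

/-- The derivative of the total cost of the agents at zero input. -/
def totalSlope (T s : ℕ) (x : ∀ i, Fin (S i).nx → ℝ) :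
    (∀ i, Finset.Ico s T → Fin (S i).nu → ℝ) →ₗ[ℝ] ℝ :=
  ∑ i, (S i).slope T s (x i) ∘ₗ LinearMap.proj i

/-- The left-hand sides of all constraints over the horizon, as a linear map. -/
def excessMap (T s : ℕ) :
    (∀ i, Finset.Ico s T → Fin (S i).nu → ℝ) →ₗ[ℝ] (Finset.Ico s T × Fin N → ℝ) where
  toFun u q := excess S (fun i => u i q.1) q.2
  map_add' u v := by
    ext q
    simp [excess, Finset.sum_add_distrib]
  map_smul' r u := by
    ext q
    simp [excess, Finset.mul_sum]

lemma totalHessian_apply (T s : ℕ) (u v : ∀ i, Finset.Ico s T → Fin (S i).nu → ℝ) :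
    totalHessian S T s u v = ∑ i, (S i).hessian T s (u i) (v i) := by
  simp [totalHessian, LinearMap.sum_apply]

lemma totalSlope_apply (T s : ℕ) (x : ∀ i, Fin (S i).nx → ℝ)
    (v : ∀ i, Finset.Ico s T → Fin (S i).nu → ℝ) :
    totalSlope S T s x v = ∑ i, (S i).slope T s (x i) (v i) := by
  simp [totalSlope, LinearMap.sum_apply]

lemma totalHessian_symm (T s : ℕ) (u v : ∀ i, Finset.Ico s T → Fin (S i).nu → ℝ) :
    totalHessian S T s u v = totalHessian S T s v u := by
  simp only [totalHessian_apply]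
  exact Finset.sum_congr rfl fun i _ => (S i).hessian_symm T s _ _

lemma totalHessian_self_pos (T s : ℕ) {u : ∀ i, Finset.Ico s T → Fin (S i).nu → ℝ} (hu : u ≠ 0) :
    0 < totalHessian S T s u u := by
  rw [totalHessian_apply]
  obtain ⟨i, hi⟩ := Function.ne_iff.1 hu
  exact Finset.sum_pos' (fun i _ => (S i).hessian_self_nonneg T s _)
    ⟨i, Finset.mem_univ i, (S i).hessian_self_pos T s hi⟩

/-- The derivative of the Lagrangian in terms of the gradients of the agents' problems. -/
lemma lagrangian_deriv (T s : ℕ) (x : ∀ i, Fin (S i).nx → ℝ)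
    (u : ∀ i, ℕ → Fin (S i).nu → ℝ) (p : ℕ → Fin N → ℝ)
    (v : ∀ i, Finset.Ico s T → Fin (S i).nu → ℝ) :
    totalHessian S T s (fun i t => u i t) v + totalSlope S T s x v +
        (fun q : Finset.Ico s T × Fin N => p q.1 q.2) ⬝ᵥ excessMap S T s v =
      ∑ i, ∑ t : Finset.Ico s T,
        (S i).gradient T s (x i) (fun t => (S i).localPrice (p t)) (u i) t ⬝ᵥ v i t := by
  have h1 : (fun q : Finset.Ico s T × Fin N => p q.1 q.2) ⬝ᵥ excessMap S T s v =
      ∑ i, ∑ t ∈ Finset.Ico s T, (S i).localPrice (p t) ⬝ᵥ (S i).extend T s (v i) t := by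
    simp only [Agent.sum_extend]
    rw [Finset.sum_comm, dotProduct, Fintype.sum_prod_type]
    exact Finset.sum_congr rfl fun t _ => (sum_localPrice_dotProduct S (p t) fun i => v i t).symm
  rw [h1, totalHessian_apply, totalSlope_apply, ← Finset.sum_add_distrib,
    ← Finset.sum_add_distrib]
  refine Finset.sum_congr rfl fun i _ => ?_
  have hu : ∀ t ∈ Finset.Ico s T, (S i).extend T s (fun t => u i t) t = u i t :=
    fun t ht => (S i).extend_apply ht _
  rw [Agent.hessian_add_slope, Agent.costForm_add_payment, Agent.sum_extend]
  exact Finset.sum_congr rfl fun t _ => by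
    rw [(S i).gradient_congr (fun _ _ => rfl) hu t.2]

/-- Saddle points of the Lagrangian are equilibria. -/
lemma isEquilibrium_of_saddle {T s : ℕ} {x : ∀ i, Fin (S i).nx → ℝ}
    {u : ∀ i, ℕ → Fin (S i).nu → ℝ} {p : ℕ → Fin N → ℝ}
    (h : ∀ v, totalHessian S T s (fun i t => u i t) v + totalSlope S T s x v +
      (fun q : Finset.Ico s T × Fin N => p q.1 q.2) ⬝ᵥ excessMap S T s v = 0)
    (hu : excessMap S T s (fun i t => u i t) = 0) : IsEquilibrium S T s x u p where
  optimal i := by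
    rw [Agent.isOptimalBid_iff]
    intro t ht
    have h1 := h fun i t => (S i).gradient T s (x i) (fun t => (S i).localPrice (p t)) (u i) t
    rw [lagrangian_deriv] at h1
    have hnn : ∀ (i : Fin M) (t : Finset.Ico s T),
        0 ≤ (S i).gradient T s (x i) (fun t => (S i).localPrice (p t)) (u i) t ⬝ᵥ
          (S i).gradient T s (x i) (fun t => (S i).localPrice (p t)) (u i) t := fun i t => by
      simpa using dotProduct_star_self_nonneg
        ((S i).gradient T s (x i) (fun t => (S i).localPrice (p t)) (u i) t)
    rw [Finset.sum_eq_zero_iff_of_nonneg fun i _ => Finset.sum_nonneg fun t _ => hnn i t] at h1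
    have h2 := h1 i (Finset.mem_univ i)
    rw [Finset.sum_eq_zero_iff_of_nonneg fun t _ => hnn i t] at h2
    exact dotProduct_self_eq_zero.1 (h2 ⟨t, ht⟩ (Finset.mem_univ _))
  clears t ht n := congrFun hu (⟨t, ht⟩, n)

/-- Extension by zero of prices given on the horizon. -/
def extendPrice {T s : ℕ} (l : Finset.Ico s T × Fin N → ℝ) (t : ℕ) (n : Fin N) : ℝ :=
  if h : t ∈ Finset.Ico s T then l (⟨t, h⟩, n) else 0

lemma extendPrice_apply {T s t : ℕ} (ht : t ∈ Finset.Ico s T) (l : Finset.Ico s T × Fin N → ℝ)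
    (n : Fin N) : extendPrice l t n = l (⟨t, ht⟩, n) := dif_pos ht

lemma isEquilibrium_extend {T s : ℕ} {x : ∀ i, Fin (S i).nx → ℝ}
    {u : ∀ i, Finset.Ico s T → Fin (S i).nu → ℝ} {l : Finset.Ico s T × Fin N → ℝ}
    (h : ∀ v, totalHessian S T s u v + totalSlope S T s x v + l ⬝ᵥ excessMap S T s v = 0)
    (hu : excessMap S T s u = 0) :
    IsEquilibrium S T s x (fun i => (S i).extend T s (u i)) (extendPrice l) := by
  have h1 : (fun i (t : Finset.Ico s T) => (S i).extend T s (u i) t) = u := by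
    ext1 i
    ext1 t
    exact (S i).extend_apply t.2 _
  have h2 : (fun q : Finset.Ico s T × Fin N => extendPrice l q.1 q.2) = l := by
    ext1 q
    exact extendPrice_apply q.1.2 l q.2
  exact isEquilibrium_of_saddle S (by rw [h1, h2]; exact h) (by rw [h1]; exact hu)

lemma exists_isEquilibrium (T s : ℕ) (x : ∀ i, Fin (S i).nx → ℝ) :
    ∃ u p, IsEquilibrium S T s x u p := by
  obtain ⟨u, l, h, hu, -⟩ := exists_saddle (totalHessian S T s)
    (fun v hv => totalHessian_self_pos S T s hv) (totalSlope S T s x) (excessMap S T s) 0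
  exact ⟨_, _, isEquilibrium_extend S h hu⟩

/-- The price iteration is dual ascent for the total cost, hence tends to an equilibrium. -/
theorem exists_isEquilibrium_tendsto
    {α : ℕ → ℝ} (hα_pos : ∀ k, 0 < α k) (hα_lim : Tendsto α atTop (𝓝 0))
    (hα_sum : Tendsto (fun K => ∑ k ∈ Finset.range K, α k) atTop atTop)
    (T s : ℕ) (x : ∀ i, Fin (S i).nx → ℝ) (p₀ : ℕ → Fin N → ℝ) :
    ∃ u p, IsEquilibrium S T s x u p ∧ ∀ t ∈ Finset.Ico s T,
      (∀ n, Tendsto (fun k => priceIter S T α s x p₀ k t n) atTop (𝓝 (p t n))) ∧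
      (∀ i, Tendsto (fun k => bidIter S T α s x p₀ k i t) atTop (𝓝 (u i t))) := by
  obtain ⟨u, l, h, hu, hu_lim, hl_lim⟩ := exists_tendsto_dualAscent (totalHessian S T s)
    (fun v hv => totalHessian_self_pos S T s hv) (totalHessian_symm S T s) (totalSlope S T s x)
    (excessMap S T s) hα_pos hα_lim hα_sum
    (u := fun k i t => bidIter S T α s x p₀ k i t)
    (l := fun k q => priceIter S T α s x p₀ k q.1 q.2)
    (fun k v => by
      rw [lagrangian_deriv]
      refine Finset.sum_eq_zero fun i _ => Finset.sum_eq_zero fun t _ => ?_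
      have h := (S i).isOptimalBid_iff.1
        ((S i).isOptimalBid_bid T s (x i) (priceIter S T α s x p₀ k)) t t.2
      exact (congrArg (· ⬝ᵥ v i t) h).trans (zero_dotProduct _))
    (fun k => rfl)
  refine ⟨_, _, isEquilibrium_extend S h hu, fun t ht => ⟨fun n => ?_, fun i => ?_⟩⟩
  · rw [extendPrice_apply ht]
    exact tendsto_pi_nhds.1 hl_lim (⟨t, ht⟩, n)
  · rw [(S i).extend_apply ht]
    exact tendsto_pi_nhds.1 (tendsto_pi_nhds.1 hu_lim i) ⟨t, ht⟩

lemma tendsto_priceIter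
    {α : ℕ → ℝ} (hα_pos : ∀ k, 0 < α k) (hα_lim : Tendsto α atTop (𝓝 0))
    (hα_sum : Tendsto (fun K => ∑ k ∈ Finset.range K, α k) atTop atTop)
    (T s : ℕ) (x : ∀ i, Fin (S i).nx → ℝ) (p₀ : ℕ → Fin N → ℝ) {t : ℕ} (ht : t ∈ Finset.Ico s T) (n : Fin N) :
    Tendsto (fun k => priceIter S T α s x p₀ k t n) atTop (𝓝 (limitPrice S T α s x p₀ t n)) := by
  obtain ⟨u, p, -, h⟩ := exists_isEquilibrium_tendsto S hα_pos hα_lim hα_sum T s x p₀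
  exact tendsto_nhds_limUnder ⟨_, (h t ht).1 n⟩

lemma tendsto_bidIter
    {α : ℕ → ℝ} (hα_pos : ∀ k, 0 < α k) (hα_lim : Tendsto α atTop (𝓝 0))
    (hα_sum : Tendsto (fun K => ∑ k ∈ Finset.range K, α k) atTop atTop)
    (T s : ℕ) (x : ∀ i, Fin (S i).nx → ℝ) (p₀ : ℕ → Fin N → ℝ) {t : ℕ} (ht : t ∈ Finset.Ico s T) (i : Fin M) :
    Tendsto (fun k => bidIter S T α s x p₀ k i t) atTop (𝓝 (limitBid S T α s x p₀ i t)) := by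
  obtain ⟨u, p, -, h⟩ := exists_isEquilibrium_tendsto S hα_pos hα_lim hα_sum T s x p₀
  exact tendsto_nhds_limUnder ⟨_, (h t ht).2 i⟩

lemma isEquilibrium_limit
    {α : ℕ → ℝ} (hα_pos : ∀ k, 0 < α k) (hα_lim : Tendsto α atTop (𝓝 0))
    (hα_sum : Tendsto (fun K => ∑ k ∈ Finset.range K, α k) atTop atTop)
    (T s : ℕ) (x : ∀ i, Fin (S i).nx → ℝ) (p₀ : ℕ → Fin N → ℝ) :
    IsEquilibrium S T s x (limitBid S T α s x p₀) (limitPrice S T α s x p₀) := by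
  obtain ⟨u, p, hup, h⟩ := exists_isEquilibrium_tendsto S hα_pos hα_lim hα_sum T s x p₀
  exact hup.congr (fun t ht i => ((h t ht).2 i).limUnder_eq.symm)
    (fun t ht n => ((h t ht).1 n).limUnder_eq.symm)

/-- Equilibria can be selected linearly in the initial states. -/
lemma exists_linear_isEquilibrium (T s : ℕ) :
    ∃ (U : (∀ i, Fin (S i).nx → ℝ) →ₗ[ℝ] (∀ i, ℕ → Fin (S i).nu → ℝ))
      (p : (∀ i, Fin (S i).nx → ℝ) →ₗ[ℝ] (ℕ → Fin N → ℝ)),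
      ∀ x, IsEquilibrium S T s x (U x) (p x) := by
  let V : Submodule ℝ ((∀ i, Fin (S i).nx → ℝ) × (∀ i, ℕ → Fin (S i).nu → ℝ) ×
      (ℕ → Fin N → ℝ)) :=
    { carrier := {q | IsEquilibrium S T s q.1 q.2.1 q.2.2}
      add_mem' := fun h h' => IsEquilibrium.add h h'
      zero_mem' := by
        obtain ⟨u, p, h⟩ := exists_isEquilibrium S T s 0
        have h1 := h.smul 0
        simp only [zero_smul] at h1
        exact h1
      smul_mem' := fun r _ h => IsEquilibrium.smul r h }
  obtain ⟨σ, hσ⟩ := (LinearMap.fst ℝ _ _ ∘ₗ V.subtype).exists_rightInverse_of_surjective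
    (LinearMap.range_eq_top.2 fun x => by
      obtain ⟨u, p, h⟩ := exists_isEquilibrium S T s x
      exact ⟨⟨(x, u, p), h⟩, rfl⟩)
  refine ⟨LinearMap.fst ℝ _ _ ∘ₗ LinearMap.snd ℝ _ _ ∘ₗ V.subtype ∘ₗ σ,
    LinearMap.snd ℝ _ _ ∘ₗ LinearMap.snd ℝ _ _ ∘ₗ V.subtype ∘ₗ σ, fun x => ?_⟩
  have h1 : IsEquilibrium S T s (σ x).1.1 (σ x).1.2.1 (σ x).1.2.2 := (σ x).2
  have h2 : (σ x).1.1 = x := LinearMap.congr_fun hσ x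
  rw [h2] at h1
  exact h1

/-- The feedback form of the equilibria: the first inputs, the first local prices and the
costates are linear functions of the current states, related by the costate recursion and the
first-order condition. Since the revised plan at time `s + 1` continues the plan made at time
`s` when there is no noise, the same costate maps serve for both. -/
lemma exists_feedback (T : ℕ) :
    ∃ (K L : ℕ → ∀ i, (∀ j, Fin (S j).nx → ℝ) →ₗ[ℝ] (Fin (S i).nu → ℝ))
      (μ : ℕ → ∀ i, (∀ j, Fin (S j).nx → ℝ) →ₗ[ℝ] (Fin (S i).nx → ℝ)),
      (∀ s < T, ∀ x u p, IsEquilibrium S T s x u p → ∀ i,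
        u i s = K s i x ∧ (S i).localPrice (p s) = L s i x) ∧
      (∀ i, μ T i = 0) ∧
      ∀ s < T, ∀ x i,
        μ s i x = (S i).Q *ᵥ x i + (S i).Aᵀ *ᵥ
          μ (s + 1) i (fun j => (S j).A *ᵥ x j + (S j).B *ᵥ K s j x) ∧
        (2 : ℝ) • ((S i).R *ᵥ K s i x + (S i).Bᵀ *ᵥ
          μ (s + 1) i (fun j => (S j).A *ᵥ x j + (S j).B *ᵥ K s j x)) + L s i x = 0 := by
  choose U p hUp using exists_linear_isEquilibrium S T
  let K : ℕ → ∀ i, (∀ j, Fin (S j).nx → ℝ) →ₗ[ℝ] (Fin (S i).nu → ℝ) := fun s i =>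
    LinearMap.proj s ∘ₗ LinearMap.proj i ∘ₗ U s
  let L : ℕ → ∀ i, (∀ j, Fin (S j).nx → ℝ) →ₗ[ℝ] (Fin (S i).nu → ℝ) := fun s i =>
    { toFun := fun x => (S i).localPrice (p s x s)
      map_add' := fun x y => by simp [Agent.localPrice, add_smul, Finset.sum_add_distrib]
      map_smul' := fun r x => by simp [Agent.localPrice, mul_smul, Finset.smul_sum] }
  let μ : ℕ → ∀ i, (∀ j, Fin (S j).nx → ℝ) →ₗ[ℝ] (Fin (S i).nx → ℝ) := fun s i =>
    { toFun := fun x => (S i).costate T ((S i).state s (x i) (U s x i) 0) s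
      map_add' := fun x y => by
        have h := (S i).state_add s (x i) (y i) (U s x i) (U s y i) 0 0
        rw [add_zero] at h
        rw [map_add, Pi.add_apply, Pi.add_apply, h, Agent.costate_add]
      map_smul' := fun r x => by
        have h := (S i).state_smul s r (x i) (U s x i) 0
        rw [smul_zero] at h
        rw [map_smul, Pi.smul_apply, Pi.smul_apply, h, Agent.costate_smul, RingHom.id_apply] }
  have hμ : ∀ s x i, (S i).costate T ((S i).state s (x i) (U s x i) 0) (s + 1) =
      μ (s + 1) i (fun j => (S j).A *ᵥ x j + (S j).B *ᵥ K s j x) := by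
    intro s x i
    refine (S i).costate_congr fun τ hτ => ?_
    have hτ' := Finset.mem_Ico.1 hτ
    rw [← (S i).state_restart (show s < τ by omega), (S i).state_succ le_rfl,
      (S i).state_of_le le_rfl, Pi.zero_apply, add_zero]
    exact (S i).state_congr _ 0
      (fun t ht => (hUp (s + 1) _).input_unique (hUp s x).tail ht i) hτ'.2.le
  refine ⟨K, L, μ, fun s hs x u q h i => ?_, fun i => ?_, fun s hs x i => ⟨?_, ?_⟩⟩
  · have hs' : s ∈ Finset.Ico s T := Finset.mem_Ico.2 ⟨le_rfl, hs⟩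
    exact ⟨(hUp s x).input_unique h hs' i, (hUp s x).localPrice_unique h hs' i⟩
  · exact LinearMap.ext fun x => (S i).costate_self _ _
  · rw [← hμ]
    change (S i).costate T ((S i).state s (x i) (U s x i) 0) s = _
    rw [(S i).costate_of_lt hs, (S i).state_of_le le_rfl]
  · rw [← hμ]
    exact (S i).isOptimalBid_iff.1 ((hUp s x).optimal i) s (Finset.mem_Ico.2 ⟨le_rfl, hs⟩)

end Market

/-! ### Square-integrable processes driven by centred independent noise -/

section Information

variable {Ω : Type*} {M N : ℕ} {S : Fin M → Agent N} {X₀ : (i : Fin M) → Ω → Fin (S i).nx → ℝ}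
  {W : (i : Fin M) → ℕ → Ω → Fin (S i).nx → ℝ}

lemma info_mono {s t : ℕ} (h : s ≤ t) : info S X₀ W s ≤ info S X₀ W t :=
  sup_le_sup le_rfl <| iSup_mono fun i => iSup_le fun r =>
    le_iSup (fun r : Fin t => MeasurableSpace.comap (W i r) inferInstance) ⟨r, by omega⟩

lemma measurable_info_init (i : Fin M) (t : ℕ) : Measurable[info S X₀ W t] (X₀ i) :=
  (comap_measurable (X₀ i)).mono
    ((le_iSup (fun i => MeasurableSpace.comap (X₀ i) inferInstance) i).trans le_sup_left) le_rfl

lemma measurable_info_noise (i : Fin M) {r t : ℕ} (h : r < t) :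
    Measurable[info S X₀ W t] (W i r) :=
  (comap_measurable (W i r)).mono
    (((le_iSup (fun r : Fin t => MeasurableSpace.comap (W i r) inferInstance) ⟨r, h⟩).trans
      (le_iSup (fun i => ⨆ r : Fin t, MeasurableSpace.comap (W i r) inferInstance) i)).trans
      le_sup_right) le_rfl

end Information

section Stochastic

variable {Ω : Type*} [MeasurableSpace Ω] {P : Measure Ω}

lemma memLp_linearMap {E F : Type*} [NormedAddCommGroup E] [NormedSpace ℝ E]
    [FiniteDimensional ℝ E] [NormedAddCommGroup F] [NormedSpace ℝ F] (f : E →ₗ[ℝ] F) {X : Ω → E}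
    (hX : MemLp X 2 P) : MemLp (fun ω => f (X ω)) 2 P :=
  (LinearMap.toContinuousLinearMap f).comp_memLp' hX

lemma integrable_dotProduct {ι : Type*} [Fintype ι] {X Y : Ω → ι → ℝ} (hX : MemLp X 2 P)
    (hY : MemLp Y 2 P) : Integrable (fun ω => X ω ⬝ᵥ Y ω) P :=
  integrable_finsetSum _ fun c _ => (memLp_pi_iff.1 hX c).integrable_mul (memLp_pi_iff.1 hY c)

variable {M N : ℕ} {S : Fin M → Agent N}

namespace Agent

variable (a : Agent N)

lemma memLp_state {T : ℕ} {x : Ω → Fin a.nx → ℝ} {u : ℕ → Ω → Fin a.nu → ℝ}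
    {w : ℕ → Ω → Fin a.nx → ℝ} (hx : MemLp x 2 P) (hu : ∀ t < T, MemLp (u t) 2 P)
    (hw : ∀ t < T, MemLp (w t) 2 P) {t : ℕ} (ht : t ≤ T) :
    MemLp (fun ω => a.state 0 (x ω) (fun t => u t ω) (fun t => w t ω) t) 2 P := by
  induction t with
  | zero => exact hx
  | succ t ih =>
    simp only [a.state_succ (Nat.zero_le t)]
    exact ((memLp_linearMap (mulVecLin a.A) (ih (by omega))).add
      (memLp_linearMap (mulVecLin a.B) (hu t ht))).add (hw t ht)

lemma integrable_cost {T : ℕ} {x : Ω → Fin a.nx → ℝ} {u : ℕ → Ω → Fin a.nu → ℝ}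
    {w : ℕ → Ω → Fin a.nx → ℝ} (hx : MemLp x 2 P) (hu : ∀ t < T, MemLp (u t) 2 P)
    (hw : ∀ t < T, MemLp (w t) 2 P) :
    Integrable (fun ω => a.cost T 0 (x ω) (fun t => u t ω) (fun t => w t ω)) P := by
  refine integrable_finsetSum _ fun t ht => ?_
  have ht' := (Finset.mem_Ico.1 ht).2
  have h1 := a.memLp_state hx hu hw ht'.le
  exact (integrable_dotProduct h1 (memLp_linearMap (mulVecLin a.Q) h1)).add
    (integrable_dotProduct (hu t ht') (memLp_linearMap (mulVecLin a.R) (hu t ht')))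

lemma integrable_netCost {T : ℕ} {x : Ω → Fin a.nx → ℝ} {π u : ℕ → Ω → Fin a.nu → ℝ}
    {w : ℕ → Ω → Fin a.nx → ℝ} (hx : MemLp x 2 P) (hπ : ∀ t < T, MemLp (π t) 2 P)
    (hu : ∀ t < T, MemLp (u t) 2 P) (hw : ∀ t < T, MemLp (w t) 2 P) :
    Integrable (fun ω => a.netCost T 0 (x ω) (fun t => π t ω) (fun t => u t ω)
      (fun t => w t ω)) P :=
  (a.integrable_cost hx hu hw).add <| integrable_finsetSum _ fun t ht =>
    integrable_dotProduct (hπ t (Finset.mem_Ico.1 ht).2) (hu t (Finset.mem_Ico.1 ht).2)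

/-- Inputs of finite expected cost are square-integrable, since `R` is positive definite. -/
lemma memLp_of_lintegral_cost_ne_top {T : ℕ} {x : Ω → Fin a.nx → ℝ} {u : ℕ → Ω → Fin a.nu → ℝ}
    {w : ℕ → Ω → Fin a.nx → ℝ} {C : Ω → ℝ}
    (hC : ∀ ω, a.cost T 0 (x ω) (fun t => u t ω) (fun t => w t ω) ≤ C ω)
    (h : ∫⁻ ω, ENNReal.ofReal (C ω) ∂P ≠ ⊤) {t : ℕ} (ht : t < T) (hu : Measurable (u t)) :
    MemLp (u t) 2 P := by
  obtain ⟨c, hc, hcR⟩ := exists_pos_mul_sq_norm_le (Matrix.toLinearMap₂' ℝ a.R)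
    (fun v hv => by rw [Matrix.toLinearMap₂'_apply']; exact a.dotProduct_R_pos hv)
  rw [memLp_two_iff_integrable_sq_norm hu.aestronglyMeasurable]
  refine ⟨(hu.norm.pow_const 2).aestronglyMeasurable, ?_⟩
  rw [hasFiniteIntegral_iff_ofReal (Eventually.of_forall fun ω => sq_nonneg _)]
  calc ∫⁻ ω, ENNReal.ofReal (‖u t ω‖ ^ 2) ∂P
      ≤ ∫⁻ ω, ENNReal.ofReal c⁻¹ * ENNReal.ofReal (C ω) ∂P := by
        refine lintegral_mono fun ω => ?_
        rw [← ENNReal.ofReal_mul (inv_nonneg.2 hc.le)]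
        refine ENNReal.ofReal_le_ofReal ?_
        rw [le_inv_mul_iff₀ hc]
        refine (hcR _).trans ?_
        rw [Matrix.toLinearMap₂'_apply']
        exact (a.dotProduct_R_le_cost (Finset.mem_Ico.2 ⟨Nat.zero_le t, ht⟩) (x ω)
          (fun t => u t ω) (fun t => w t ω)).trans (hC ω)
    _ = ENNReal.ofReal c⁻¹ * ∫⁻ ω, ENNReal.ofReal (C ω) ∂P :=
        lintegral_const_mul' _ _ ENNReal.ofReal_ne_top
    _ < ⊤ := ENNReal.mul_lt_top ENNReal.ofReal_lt_top (lt_top_iff_ne_top.2 h)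

end Agent

/-- What the argument uses about the primitive random vectors: they are independent and
square-integrable, and the noises are centred. -/
structure IsCentredNoise (S : Fin M → Agent N) (P : Measure Ω) (T : ℕ)
    (X₀ : (i : Fin M) → Ω → Fin (S i).nx → ℝ)
    (W : (i : Fin M) → ℕ → Ω → Fin (S i).nx → ℝ) : Prop where
  measurable_init : ∀ i, Measurable (X₀ i)
  measurable_noise : ∀ i, ∀ t < T, Measurable (W i t)
  memLp_init : ∀ i, MemLp (X₀ i) 2 P
  memLp_noise : ∀ i, ∀ t < T, MemLp (W i t) 2 P
  integral_noise : ∀ i, ∀ t < T, ∀ c, ∫ ω, W i t ω c ∂P = 0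
  indep : iIndepFun (primitives S T X₀ W) P

lemma memLp_of_hasLaw_gaussian {n : ℕ} {X : Ω → Fin n → ℝ} {Sig : Matrix (Fin n) (Fin n) ℝ}
    (h : HasLaw (fun ω => WithLp.toLp 2 (X ω)) (multivariateGaussian 0 Sig) P) :
    MemLp X 2 P := by
  have h1 : MemLp (id : EuclideanSpace ℝ (Fin n) → _) 2
      (P.map fun ω => WithLp.toLp 2 (X ω)) := by
    rw [h.map_eq]
    exact IsGaussian.memLp_two_id
  rw [memLp_map_measure_iff aestronglyMeasurable_id h.aemeasurable] at h1
  exact MemLp.of_eval fun c => h1.eval_piLp c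

lemma integral_eq_zero_of_hasLaw_gaussian {n : ℕ} {X : Ω → Fin n → ℝ}
    {Sig : Matrix (Fin n) (Fin n) ℝ} [IsFiniteMeasure P]
    (h : HasLaw (fun ω => WithLp.toLp 2 (X ω)) (multivariateGaussian 0 Sig) P) (c : Fin n) :
    ∫ ω, X ω c ∂P = 0 := by
  have h1 := h.integral_eq
  rw [integral_id_multivariateGaussian] at h1
  have h2 := eval_integral_piLp (f := fun ω => WithLp.toLp 2 (X ω)) (μ := P) (fun c =>
    ((memLp_of_hasLaw_gaussian h).eval c).integrable one_le_two) c
  rw [h1] at h2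
  exact h2.symm

variable {T : ℕ} {X₀ : (i : Fin M) → Ω → Fin (S i).nx → ℝ}
    {W : (i : Fin M) → ℕ → Ω → Fin (S i).nx → ℝ}

namespace IsCentredNoise

lemma info_le (h : IsCentredNoise S P T X₀ W) {t : ℕ} (ht : t ≤ T) : info S X₀ W t ≤ ‹MeasurableSpace Ω› :=
  sup_le (iSup_le fun i => (h.measurable_init i).comap_le) <| iSup_le fun i => iSup_le fun r =>
    (h.measurable_noise i r (by omega)).comap_le

/-- The noise at time `t` is independent of the information at time `t`. -/
lemma indep_info (h : IsCentredNoise S P T X₀ W) {t : ℕ} (ht : t < T) :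
    Indep (⨆ i, MeasurableSpace.comap (W i t) inferInstance) (info S X₀ W t) P := by
  have hle : ∀ q, MeasurableSpace.comap (primitives S T X₀ W q) inferInstance ≤
      ‹MeasurableSpace Ω› := by
    rintro ⟨i, _ | r⟩
    · exact (h.measurable_init i).comap_le
    · exact (h.measurable_noise i r r.2).comap_le
  -- the noises at time `t`, and the primitive vectors that generate the information
  let now : Set (Fin M × Option (Fin T)) := {q | q.2 = some ⟨t, ht⟩}
  let past : Set (Fin M × Option (Fin T)) := {q | ∀ r, q.2 = some r → (r : ℕ) < t}
  have hdisj : Disjoint now past := Set.disjoint_left.2 fun q hq hq' => (hq' _ hq).ne rfl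
  refine indep_of_indep_of_le (indep_iSup_of_disjoint hle
    ((iIndepFun_iff_iIndep _ _ _).1 h.indep) hdisj) (iSup_le fun i => ?_)
    (sup_le (iSup_le fun i => ?_) (iSup_le fun i => iSup_le fun r => ?_))
  · exact le_iSup₂_of_le (i, some ⟨t, ht⟩) rfl le_rfl
  · exact le_iSup₂_of_le (i, none) (fun r hr => by cases hr) le_rfl
  · refine le_iSup₂_of_le (i, some ⟨r, by omega⟩) (fun r' hr' => ?_) le_rfl
    cases hr'
    exact r.2

/-- Linear functions of the noise at time `t` are uncorrelated with everything known at
time `t`. -/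
lemma integral_dotProduct_eq_zero [IsProbabilityMeasure P] (h : IsCentredNoise S P T X₀ W) {t : ℕ} (ht : t < T) {n : ℕ}
    (f : (∀ j, Fin (S j).nx → ℝ) →ₗ[ℝ] (Fin n → ℝ)) {Y : Ω → Fin n → ℝ}
    (hY : Measurable[info S X₀ W t] Y) (hY2 : MemLp Y 2 P) :
    ∫ ω, f (fun j => W j t ω) ⬝ᵥ Y ω ∂P = 0 := by
  have hW2 : MemLp (fun ω j => W j t ω) 2 P := MemLp.of_eval fun j => h.memLp_noise j t ht
  have hf2 := memLp_linearMap f hW2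
  have hf0 : ∀ c, ∫ ω, f (fun j => W j t ω) c ∂P = 0 := by
    intro c
    have hi : ∀ j, Integrable (fun ω => W j t ω) P :=
      fun j => (h.memLp_noise j t ht).integrable one_le_two
    have h1 : ∫ ω, (fun j => W j t ω) ∂P = 0 := by
      ext j c
      rw [eval_integral hi, eval_integral fun c => (hi j).eval c]
      exact h.integral_noise j t ht c
    have h2 := (LinearMap.toContinuousLinearMap f).integral_comp_comm
      (hW2.integrable one_le_two)
    rw [h1, map_zero] at h2
    rw [← eval_integral fun c => (hf2.integrable one_le_two).eval c]
    exact congrFun h2 c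
  have hWm : Measurable[⨆ i, MeasurableSpace.comap (W i t) inferInstance]
      (fun ω j => W j t ω) :=
    @measurable_pi_lambda _ _ _ (_) _ _ fun j => (comap_measurable (W j t)).mono
      (le_iSup (fun i => MeasurableSpace.comap (W i t) inferInstance) j) le_rfl
  have hfm : Measurable[⨆ i, MeasurableSpace.comap (W i t) inferInstance]
      (fun ω => f (fun j => W j t ω)) :=
    f.continuous_of_finiteDimensional.measurable.comp hWm
  simp only [dotProduct]
  have hint : ∀ c ∈ Finset.univ, Integrable (fun ω => f (fun j => W j t ω) c * Y ω c) P :=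
    fun c _ => (hf2.eval c).integrable_mul (hY2.eval c)
  rw [integral_finsetSum _ hint]
  refine Finset.sum_eq_zero fun c _ => ?_
  have hind : IndepFun (fun ω => f (fun j => W j t ω) c) (fun ω => Y ω c) P := by
    rw [IndepFun_iff_Indep]
    exact indep_of_indep_of_le (h.indep_info ht) ((measurable_pi_apply c).comp hfm).comap_le
      ((measurable_pi_apply c).comp hY).comap_le
  rw [hind.integral_fun_mul_eq_mul_integral (hf2.eval c).1 (hY2.eval c).1, hf0, zero_mul]

end IsCentredNoise

end Stochastic

/-! ### Optimality of the closed loop -/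

section ClosedLoop

variable {M N : ℕ} {S : Fin M → Agent N} {T : ℕ}
  {K L : ℕ → ∀ i, (∀ j, Fin (S j).nx → ℝ) →ₗ[ℝ] (Fin (S i).nu → ℝ)}
  {μ : ℕ → ∀ i, (∀ j, Fin (S j).nx → ℝ) →ₗ[ℝ] (Fin (S i).nx → ℝ)}

/-- Pathwise comparison of an input `v` of agent `i` with the feedback input `u`, at the local
prices given by the feedback law. The first-order term reduces to the revisions
`μ (t + 1) i (w t)` that the noise causes in the costate, because without noise the plans made
at successive times agree. -/
lemma netCost_eq_of_feedback {i : Fin M} (hμT : μ T i = 0)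
    (hμ : ∀ s < T, ∀ x,
      μ s i x = (S i).Q *ᵥ x i + (S i).Aᵀ *ᵥ
        μ (s + 1) i (fun j => (S j).A *ᵥ x j + (S j).B *ᵥ K s j x) ∧
      (2 : ℝ) • ((S i).R *ᵥ K s i x + (S i).Bᵀ *ᵥ
        μ (s + 1) i (fun j => (S j).A *ᵥ x j + (S j).B *ᵥ K s j x)) + L s i x = 0)
    {X : ℕ → ∀ j, Fin (S j).nx → ℝ} {w : ∀ j, ℕ → Fin (S j).nx → ℝ}
    (hX : ∀ t < T, ∀ j,
      X (t + 1) j = (S j).A *ᵥ X t j + (S j).B *ᵥ K t j (X t) + w j t)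
    {π u : ℕ → Fin (S i).nu → ℝ} (hu : ∀ t < T, u t = K t i (X t))
    (hπ : ∀ t < T, π t = L t i (X t)) (v : ℕ → Fin (S i).nu → ℝ) :
    (S i).netCost T 0 (X 0 i) π v (w i) = (S i).netCost T 0 (X 0 i) π u (w i) +
      2 * ∑ t ∈ Finset.range T,
        μ (t + 1) i (fun j => w j t) ⬝ᵥ (S i).state 0 0 (v - u) 0 (t + 1) +
      (S i).cost T 0 0 (v - u) 0 := by
  have hstate : ∀ t ≤ T, (S i).state 0 (X 0 i) u (w i) t = X t i := by
    intro t ht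
    induction t with
    | zero => rfl
    | succ t ih => rw [(S i).state_succ (Nat.zero_le t), ih (by omega), hX t ht i, hu t ht]
  let φ : ℕ → Fin (S i).nx → ℝ := fun t =>
    μ (t + 1) i (fun j => (S j).A *ᵥ X t j + (S j).B *ᵥ K t j (X t))
  have h1 := (S i).costForm_eq (Nat.zero_le T) (z := (S i).state 0 (X 0 i) u (w i))
    (μ := fun t => μ t i (X t)) (φ := φ)
    (fun t ht => by
      have ht' := (Finset.mem_Ico.1 ht).2
      rw [hstate t ht'.le]
      exact (hμ t ht' (X t)).1)
    (by rw [hμT]; rfl) u (v - u)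
  have h2 : ∑ t ∈ Finset.Ico 0 T,
        (μ (t + 1) i (X (t + 1)) - φ t) ⬝ᵥ (S i).state 0 0 (v - u) 0 (t + 1) =
      ∑ t ∈ Finset.Ico 0 T,
        μ (t + 1) i (fun j => w j t) ⬝ᵥ (S i).state 0 0 (v - u) 0 (t + 1) := by
    refine Finset.sum_congr rfl fun t ht => ?_
    rw [← map_sub]
    congr 2
    ext1 j
    rw [Pi.sub_apply, hX t (Finset.mem_Ico.1 ht).2 j, add_sub_cancel_left]
  have h3 : ∀ t ∈ Finset.Ico 0 T, 2 * (((S i).R *ᵥ u t + (S i).Bᵀ *ᵥ φ t) ⬝ᵥ (v - u) t) +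
      π t ⬝ᵥ (v - u) t = 0 := by
    intro t ht
    have ht' := (Finset.mem_Ico.1 ht).2
    rw [← smul_eq_mul, ← smul_dotProduct, ← add_dotProduct, hu t ht', hπ t ht',
      (hμ t ht' (X t)).2, zero_dotProduct]
  have h4 := (S i).netCost_add_input T 0 (X 0 i) π u (v - u) (w i)
  rw [add_sub_cancel, h1, h2] at h4
  have h5 := Finset.sum_eq_zero h3
  rw [Finset.sum_add_distrib, ← Finset.mul_sum] at h5
  rw [Finset.range_eq_Ico]
  linarith

variable {Ω : Type*}
  {X₀ : (i : Fin M) → Ω → Fin (S i).nx → ℝ} {W : (i : Fin M) → ℕ → Ω → Fin (S i).nx → ℝ}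
  {α : ℕ → ℝ} {p₀ : Ω → ℕ → ℕ → Fin N → ℝ}

lemma measurable_schemeState
    (hK : ∀ t < T, ∀ ω i,
      schemeInput S T α p₀ X₀ W i t ω = K t i (schemeState S T α p₀ X₀ W t ω))
    {t : ℕ} (ht : t ≤ T) : Measurable[info S X₀ W t] (schemeState S T α p₀ X₀ W t) := by
  induction t with
  | zero => exact @measurable_pi_lambda _ _ _ (_) _ _ fun i => measurable_info_init i 0
  | succ t ih =>
    have h1 : Measurable[info S X₀ W (t + 1)] (schemeState S T α p₀ X₀ W t) :=
      (ih (by omega)).mono (info_mono (Nat.le_succ t)) le_rfl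
    refine @measurable_pi_lambda _ _ _ (_) _ _ fun i => ?_
    have h2 : Measurable[info S X₀ W (t + 1)] (schemeInput S T α p₀ X₀ W i t) := by
      rw [funext fun ω => hK t ht ω i]
      exact (K t i).continuous_of_finiteDimensional.measurable.comp h1
    exact (((mulVecLin (S i).A).continuous_of_finiteDimensional.measurable.comp
      ((measurable_pi_apply i).comp h1)).add
      ((mulVecLin (S i).B).continuous_of_finiteDimensional.measurable.comp h2)).add
      (measurable_info_noise i (Nat.lt_succ_self t))

/-- The response of the state to inputs is known one step ahead: at time `r` it depends only on the
inputs before `r`. At `r = 0` the truncated `r - 1` is harmless, the state being zero. -/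
lemma measurable_state_info {i : Fin M} {t : ℕ} {δ : ℕ → Ω → Fin (S i).nu → ℝ}
    (hδ : ∀ r < t, Measurable[info S X₀ W r] (δ r)) {r : ℕ} (hr : r ≤ t) :
    Measurable[info S X₀ W (r - 1)]
      (fun ω => (S i).state 0 0 (fun r => δ r ω) 0 r) := by
  induction r with
  | zero => exact measurable_const
  | succ r ih =>
    simp only [(S i).state_succ (Nat.zero_le r), Pi.zero_apply, add_zero]
    exact ((mulVecLin (S i).A).continuous_of_finiteDimensional.measurable.comp
      ((ih (by omega)).mono (info_mono (Nat.sub_le r 1)) le_rfl)).add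
      ((mulVecLin (S i).B).continuous_of_finiteDimensional.measurable.comp (hδ r hr))

variable [MeasurableSpace Ω] {P : Measure Ω}

lemma memLp_schemeState (h : IsCentredNoise S P T X₀ W)
    (hK : ∀ t < T, ∀ ω i,
      schemeInput S T α p₀ X₀ W i t ω = K t i (schemeState S T α p₀ X₀ W t ω))
    {t : ℕ} (ht : t ≤ T) : MemLp (schemeState S T α p₀ X₀ W t) 2 P := by
  induction t with
  | zero => exact MemLp.of_eval fun i => h.memLp_init i
  | succ t ih =>
    have h1 := ih (by omega)
    refine MemLp.of_eval fun i => ?_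
    have h2 : MemLp (schemeInput S T α p₀ X₀ W i t) 2 P := by
      rw [funext fun ω => hK t ht ω i]
      exact memLp_linearMap (K t i) h1
    exact ((memLp_linearMap (mulVecLin (S i).A) (h1.eval i)).add
      (memLp_linearMap (mulVecLin (S i).B) h2)).add (h.memLp_noise i t ht)

/-- Facing the realized local prices, the input process of the scheme is a best response of each
agent among all square-integrable adapted inputs. -/
theorem integral_netCost_schemeInput_le [IsProbabilityMeasure P]
    (h : IsCentredNoise S P T X₀ W)
    (hK : ∀ t < T, ∀ ω i,
      schemeInput S T α p₀ X₀ W i t ω = K t i (schemeState S T α p₀ X₀ W t ω))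
    (hL : ∀ t < T, ∀ ω i,
      schemeLocalPrice S T α p₀ X₀ W i t ω = L t i (schemeState S T α p₀ X₀ W t ω))
    (hμT : ∀ i, μ T i = 0)
    (hμ : ∀ s < T, ∀ x i,
      μ s i x = (S i).Q *ᵥ x i + (S i).Aᵀ *ᵥ
        μ (s + 1) i (fun j => (S j).A *ᵥ x j + (S j).B *ᵥ K s j x) ∧
      (2 : ℝ) • ((S i).R *ᵥ K s i x + (S i).Bᵀ *ᵥ
        μ (s + 1) i (fun j => (S j).A *ᵥ x j + (S j).B *ᵥ K s j x)) + L s i x = 0)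
    (i : Fin M) {V : ℕ → Ω → Fin (S i).nu → ℝ}
    (hV : ∀ t < T, Measurable[info S X₀ W t] (V t)) (hV2 : ∀ t < T, MemLp (V t) 2 P) :
    Integrable (fun ω => (S i).netCost T 0 (X₀ i ω)
      (fun t => schemeLocalPrice S T α p₀ X₀ W i t ω) (fun t => V t ω) (fun t => W i t ω)) P ∧
    ∫ ω, (S i).netCost T 0 (X₀ i ω) (fun t => schemeLocalPrice S T α p₀ X₀ W i t ω)
        (fun t => schemeInput S T α p₀ X₀ W i t ω) (fun t => W i t ω) ∂P ≤
      ∫ ω, (S i).netCost T 0 (X₀ i ω) (fun t => schemeLocalPrice S T α p₀ X₀ W i t ω)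
        (fun t => V t ω) (fun t => W i t ω) ∂P := by
  have hU : ∀ t < T, Measurable[info S X₀ W t] (schemeInput S T α p₀ X₀ W i t) := by
    intro t ht
    rw [funext fun ω => hK t ht ω i]
    exact (K t i).continuous_of_finiteDimensional.measurable.comp
      (measurable_schemeState hK ht.le)
  have hU2 : ∀ t < T, MemLp (schemeInput S T α p₀ X₀ W i t) 2 P := by
    intro t ht
    rw [funext fun ω => hK t ht ω i]
    exact memLp_linearMap (K t i) (memLp_schemeState h hK ht.le)
  have hπ2 : ∀ t < T, MemLp (schemeLocalPrice S T α p₀ X₀ W i t) 2 P := by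
    intro t ht
    rw [funext fun ω => hL t ht ω i]
    exact memLp_linearMap (L t i) (memLp_schemeState h hK ht.le)
  have hVint := (S i).integrable_netCost (h.memLp_init i) hπ2 hV2 (h.memLp_noise i)
  have hUint := (S i).integrable_netCost (h.memLp_init i) hπ2 hU2 (h.memLp_noise i)
  refine ⟨hVint, ?_⟩
  set δ : ℕ → Ω → Fin (S i).nu → ℝ := fun t => V t - schemeInput S T α p₀ X₀ W i t with hδ
  set η : ℕ → Ω → Fin (S i).nx → ℝ := fun t ω => (S i).state 0 0 (fun r => δ r ω) 0 t with hη
  have hηm : ∀ t < T, Measurable[info S X₀ W t] (η (t + 1)) := fun t ht =>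
    measurable_state_info (t := T) (fun r hr => (hV r hr).sub (hU r hr)) (r := t + 1) ht
  have hη2 : ∀ t < T, MemLp (η (t + 1)) 2 P := fun t ht =>
    (S i).memLp_state (w := 0) (x := 0) MemLp.zero
      (fun r hr => (hV2 r hr).sub (hU2 r hr)) (fun _ _ => MemLp.zero) ht
  have hW2 : ∀ t < T, MemLp (fun ω j => W j t ω) 2 P := fun t ht =>
    MemLp.of_eval fun j => h.memLp_noise j t ht
  have hterm : ∀ t ∈ Finset.range T,
      Integrable (fun ω => μ (t + 1) i (fun j => W j t ω) ⬝ᵥ η (t + 1) ω) P := fun t ht =>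
    integrable_dotProduct (memLp_linearMap (μ (t + 1) i) (hW2 t (Finset.mem_range.1 ht)))
      (hη2 t (Finset.mem_range.1 ht))
  have hD : ∫ ω, 2 * ∑ t ∈ Finset.range T,
      μ (t + 1) i (fun j => W j t ω) ⬝ᵥ η (t + 1) ω ∂P = 0 := by
    rw [integral_const_mul, integral_finsetSum _ hterm, Finset.sum_eq_zero fun t ht =>
      h.integral_dotProduct_eq_zero (Finset.mem_range.1 ht) (μ (t + 1) i)
        (hηm t (Finset.mem_range.1 ht)) (hη2 t (Finset.mem_range.1 ht)), mul_zero]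
  have hDint := (integrable_finsetSum _ hterm).const_mul 2
  rw [← add_zero (∫ ω, (S i).netCost T 0 (X₀ i ω)
    (fun t => schemeLocalPrice S T α p₀ X₀ W i t ω)
    (fun t => schemeInput S T α p₀ X₀ W i t ω) (fun t => W i t ω) ∂P), ← hD,
    ← integral_add hUint hDint]
  refine integral_mono (hUint.add hDint) hVint fun ω => ?_
  have h1 := netCost_eq_of_feedback (hμT i) (fun s hs x => hμ s hs x i)
    (X := fun t => schemeState S T α p₀ X₀ W t ω) (w := fun j t => W j t ω)
    (fun t ht j => by rw [← hK t ht ω j]; rfl)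
    (fun t ht => hK t ht ω i) (fun t ht => hL t ht ω i) (fun t => V t ω)
  have h2 := (S i).cost_nonneg T 0 0
    ((fun t => V t ω) - fun t => schemeInput S T α p₀ X₀ W i t ω) 0
  refine le_trans ?_ h1.ge
  exact le_add_of_nonneg_right h2

/-- The agents face the same constraint prices, so their payments under an admissible law add up
to zero. -/
lemma ae_sum_netCost_eq_sum_cost {U : (i : Fin M) → ℕ → Ω → Fin (S i).nu → ℝ}
    (hU : Admissible S P T X₀ W U) :
    (fun ω => ∑ i, (S i).netCost T 0 (X₀ i ω) (fun t => schemeLocalPrice S T α p₀ X₀ W i t ω)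
      (fun t => U i t ω) (fun t => W i t ω)) =ᵐ[P]
    fun ω => ∑ i, (S i).cost T 0 (X₀ i ω) (fun t => U i t ω) (fun t => W i t ω) := by
  filter_upwards [hU.constraints] with ω hω
  refine (sum_netCost S T 0 (fun i => X₀ i ω)
    (fun t => limitPrice S T α t (schemeState S T α p₀ X₀ W t ω) (p₀ ω t) t)
    (fun i t => U i t ω) (fun i t => W i t ω)).trans ?_
  rw [Finset.sum_eq_zero (s := Finset.Ico 0 T) (fun t ht => Finset.sum_eq_zero fun n _ => by
    rw [hω t (Finset.mem_Ico.1 ht).2 n, mul_zero]), add_zero]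

lemma expectedCost_eq_ofReal (h : IsCentredNoise S P T X₀ W)
    {U : (i : Fin M) → ℕ → Ω → Fin (S i).nu → ℝ} (hU : ∀ i, ∀ t < T, MemLp (U i t) 2 P) :
    expectedCost S P T X₀ W U = ENNReal.ofReal
      (∫ ω, ∑ i, (S i).cost T 0 (X₀ i ω) (fun t => U i t ω) (fun t => W i t ω) ∂P) :=
  (ofReal_integral_eq_lintegral_ofReal
    (integrable_finsetSum _ fun i _ =>
      (S i).integrable_cost (h.memLp_init i) (hU i) (h.memLp_noise i))
    (Eventually.of_forall fun _ => Finset.sum_nonneg fun i _ =>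
      (S i).cost_nonneg _ _ _ _ _)).symm

/-- If each agent's input in `U` is a best response to the realized local prices, then `U` has
the least expected cost among admissible laws: the payments of an admissible law add up to
zero. -/
theorem expectedCost_le_of_bestResponse (h : IsCentredNoise S P T X₀ W)
    {U V : (i : Fin M) → ℕ → Ω → Fin (S i).nu → ℝ} (hU : Admissible S P T X₀ W U)
    (hV : Admissible S P T X₀ W V) (hU2 : ∀ i, ∀ t < T, MemLp (U i t) 2 P)
    (hUint : ∀ i, Integrable (fun ω => (S i).netCost T 0 (X₀ i ω)
      (fun t => schemeLocalPrice S T α p₀ X₀ W i t ω) (fun t => U i t ω)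
      (fun t => W i t ω)) P)
    (hbest : ∀ i, (∀ t < T, MemLp (V i t) 2 P) →
      Integrable (fun ω => (S i).netCost T 0 (X₀ i ω)
        (fun t => schemeLocalPrice S T α p₀ X₀ W i t ω) (fun t => V i t ω)
        (fun t => W i t ω)) P ∧
      ∫ ω, (S i).netCost T 0 (X₀ i ω) (fun t => schemeLocalPrice S T α p₀ X₀ W i t ω)
          (fun t => U i t ω) (fun t => W i t ω) ∂P ≤
        ∫ ω, (S i).netCost T 0 (X₀ i ω) (fun t => schemeLocalPrice S T α p₀ X₀ W i t ω)
          (fun t => V i t ω) (fun t => W i t ω) ∂P) :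
    expectedCost S P T X₀ W U ≤ expectedCost S P T X₀ W V := by
  by_cases hfin : expectedCost S P T X₀ W V = ⊤
  · rw [hfin]
    exact le_top
  have hV2 : ∀ i, ∀ t < T, MemLp (V i t) 2 P := fun i t ht =>
    (S i).memLp_of_lintegral_cost_ne_top (x := X₀ i) (w := W i)
      (fun ω => Finset.single_le_sum
        (f := fun i => (S i).cost T 0 (X₀ i ω) (fun t => V i t ω) (fun t => W i t ω))
        (fun i _ => (S i).cost_nonneg _ _ _ _ _) (Finset.mem_univ i))
      hfin ht ((hV.adapted i t ht).mono (h.info_le ht.le) le_rfl)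
  rw [expectedCost_eq_ofReal h hU2, expectedCost_eq_ofReal h hV2]
  refine ENNReal.ofReal_le_ofReal ?_
  rw [← integral_congr_ae (ae_sum_netCost_eq_sum_cost (α := α) (p₀ := p₀) hU),
    ← integral_congr_ae (ae_sum_netCost_eq_sum_cost (α := α) (p₀ := p₀) hV),
    integral_finsetSum _ fun i _ => hUint i,
    integral_finsetSum _ fun i _ => (hbest i (hV2 i)).1]
  exact Finset.sum_le_sum fun i _ => (hbest i (hV2 i)).2

end ClosedLoop

end BidPrice

theorem theorem6 {Ω : Type*} [MeasurableSpace Ω] (P : Measure Ω) [IsProbabilityMeasure P]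
    {M N : ℕ} (T : ℕ) (S : Fin M → Agent N)
    (X₀ : (i : Fin M) → Ω → Fin (S i).nx → ℝ)
    (W : (i : Fin M) → ℕ → Ω → Fin (S i).nx → ℝ)
    (Sig₀ : (i : Fin M) → Matrix (Fin (S i).nx) (Fin (S i).nx) ℝ)
    (SigW : (i : Fin M) → ℕ → Matrix (Fin (S i).nx) (Fin (S i).nx) ℝ)
    (hSig₀ : ∀ i, (Sig₀ i).PosSemidef)
    (hSigW : ∀ i, ∀ t < T, (SigW i t).PosSemidef)
    (hX₀_meas : ∀ i, Measurable (X₀ i))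
    (hW_meas : ∀ i, ∀ t < T, Measurable (W i t))
    (hX₀_law : ∀ i, HasLaw (fun ω => WithLp.toLp 2 (X₀ i ω)) (multivariateGaussian 0 (Sig₀ i)) P)
    (hW_law : ∀ i, ∀ t < T,
      HasLaw (fun ω => WithLp.toLp 2 (W i t ω)) (multivariateGaussian 0 (SigW i t)) P)
    (h_indep : iIndepFun (primitives S T X₀ W) P)
    (α : ℕ → ℝ) (hα_pos : ∀ k, 0 < α k) (hα_lim : Tendsto α atTop (𝓝 0))
    (hα_sum : Tendsto (fun K => ∑ k ∈ Finset.range K, α k) atTop atTop)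
    (p₀ : Ω → ℕ → ℕ → Fin N → ℝ) :
    -- At each time and in each round, the bid of each agent is the unique solution of its problem.
    (∀ ω, ∀ s < T, ∀ k i,
      (S i).IsOptimalBid T s (schemeState S T α p₀ X₀ W s ω i)
        (priceIter S T α s (schemeState S T α p₀ X₀ W s ω) (p₀ ω s) k)
        (bidIter S T α s (schemeState S T α p₀ X₀ W s ω) (p₀ ω s) k i) ∧
      ∀ v, (S i).IsOptimalBid T s (schemeState S T α p₀ X₀ W s ω i)
        (priceIter S T α s (schemeState S T α p₀ X₀ W s ω) (p₀ ω s) k) v →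
        ∀ t ∈ Finset.Ico s T,
          v t = bidIter S T α s (schemeState S T α p₀ X₀ W s ω) (p₀ ω s) k i t) ∧
    -- At each time the prices and the bids converge.
    (∀ ω, ∀ s < T, ∀ t ∈ Finset.Ico s T,
      (∀ n, Tendsto (fun k => priceIter S T α s (schemeState S T α p₀ X₀ W s ω) (p₀ ω s) k t n)
        atTop (𝓝 (limitPrice S T α s (schemeState S T α p₀ X₀ W s ω) (p₀ ω s) t n))) ∧
      (∀ i, Tendsto (fun k => bidIter S T α s (schemeState S T α p₀ X₀ W s ω) (p₀ ω s) k i t)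
        atTop (𝓝 (limitBid S T α s (schemeState S T α p₀ X₀ W s ω) (p₀ ω s) i t)))) ∧
    -- The limiting bids are optimal at the limiting prices and meet the constraints, and the
    -- limiting prices are optimal for the dual problem.
    (∀ ω, ∀ s < T,
      (∀ i, (S i).IsOptimalBid T s (schemeState S T α p₀ X₀ W s ω i)
        (limitPrice S T α s (schemeState S T α p₀ X₀ W s ω) (p₀ ω s))
        (limitBid S T α s (schemeState S T α p₀ X₀ W s ω) (p₀ ω s) i)) ∧
      (∀ t ∈ Finset.Ico s T, ∀ n,
        excess S (fun i => limitBid S T α s (schemeState S T α p₀ X₀ W s ω) (p₀ ω s) i t) n = 0) ∧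
      (∀ p : ℕ → Fin N → ℝ,
        dualFunction S T s (schemeState S T α p₀ X₀ W s ω) p ≤
          dualFunction S T s (schemeState S T α p₀ X₀ W s ω)
            (limitPrice S T α s (schemeState S T α p₀ X₀ W s ω) (p₀ ω s)))) ∧
    -- The scheme is admissible, has finite cost, and attains the maximal social welfare among all
    -- admissible centralized control laws.
    expectedCost S P T X₀ W (schemeInput S T α p₀ X₀ W) ≠ ⊤ ∧
    Admissible S P T X₀ W (schemeInput S T α p₀ X₀ W) ∧
    IsGreatest (socialWelfare S P T X₀ W '' {U | Admissible S P T X₀ W U})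
      (socialWelfare S P T X₀ W (schemeInput S T α p₀ X₀ W)) ∧
    -- The realized prices are causal, and facing them each agent by itself has the socially
    -- optimal input process as an optimal response.
    (∀ i, ∀ t < T, Measurable[info S X₀ W t] (schemeLocalPrice S T α p₀ X₀ W i t)) ∧
    (∀ i, Integrable (fun ω => (S i).netCost T 0 (X₀ i ω)
        (fun t => schemeLocalPrice S T α p₀ X₀ W i t ω)
        (fun t => schemeInput S T α p₀ X₀ W i t ω) (fun t => W i t ω)) P ∧
      ∀ V : ℕ → Ω → Fin (S i).nu → ℝ,
        (∀ t < T, Measurable[info S X₀ W t] (V t)) → (∀ t < T, MemLp (V t) 2 P) →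
        Integrable (fun ω => (S i).netCost T 0 (X₀ i ω)
          (fun t => schemeLocalPrice S T α p₀ X₀ W i t ω)
          (fun t => V t ω) (fun t => W i t ω)) P ∧
        ∫ ω, (S i).netCost T 0 (X₀ i ω) (fun t => schemeLocalPrice S T α p₀ X₀ W i t ω)
            (fun t => schemeInput S T α p₀ X₀ W i t ω) (fun t => W i t ω) ∂P ≤
          ∫ ω, (S i).netCost T 0 (X₀ i ω) (fun t => schemeLocalPrice S T α p₀ X₀ W i t ω)
            (fun t => V t ω) (fun t => W i t ω) ∂P) := by
  have hnoise : IsCentredNoise S P T X₀ W :=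
    { measurable_init := hX₀_meas
      measurable_noise := hW_meas
      memLp_init := fun i => memLp_of_hasLaw_gaussian (hX₀_law i)
      memLp_noise := fun i t ht => memLp_of_hasLaw_gaussian (hW_law i t ht)
      integral_noise := fun i t ht => integral_eq_zero_of_hasLaw_gaussian (hW_law i t ht)
      indep := h_indep }
  have heq : ∀ ω s, IsEquilibrium S T s (schemeState S T α p₀ X₀ W s ω)
      (limitBid S T α s (schemeState S T α p₀ X₀ W s ω) (p₀ ω s))
      (limitPrice S T α s (schemeState S T α p₀ X₀ W s ω) (p₀ ω s)) := fun ω s =>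
    isEquilibrium_limit S hα_pos hα_lim hα_sum T s _ _
  obtain ⟨K, L, μ, hKL, hμT, hμ⟩ := exists_feedback S T
  have hK : ∀ t < T, ∀ ω i,
      schemeInput S T α p₀ X₀ W i t ω = K t i (schemeState S T α p₀ X₀ W t ω) :=
    fun t ht ω i => (hKL t ht _ _ _ (heq ω t) i).1
  have hL : ∀ t < T, ∀ ω i,
      schemeLocalPrice S T α p₀ X₀ W i t ω = L t i (schemeState S T α p₀ X₀ W t ω) :=
    fun t ht ω i => (hKL t ht _ _ _ (heq ω t) i).2
  have hU2 : ∀ i, ∀ t < T, MemLp (schemeInput S T α p₀ X₀ W i t) 2 P := by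
    intro i t ht
    rw [funext fun ω => hK t ht ω i]
    exact memLp_linearMap (K t i) (memLp_schemeState hnoise hK ht.le)
  have hadm : Admissible S P T X₀ W (schemeInput S T α p₀ X₀ W) :=
    { adapted := fun i t ht => by
        rw [funext fun ω => hK t ht ω i]
        exact (K t i).continuous_of_finiteDimensional.measurable.comp
          (measurable_schemeState hK ht.le)
      constraints := Eventually.of_forall fun ω t ht n =>
        (heq ω t).clears t (Finset.mem_Ico.2 ⟨le_rfl, ht⟩) n }
  have hbest := integral_netCost_schemeInput_le hnoise hK hL hμT hμ
  have hUint := fun i => (hbest i (hadm.adapted i) (hU2 i)).1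
  refine ⟨fun ω s _ k i => ⟨(S i).isOptimalBid_bid T s _ _, fun v hv t ht =>
    ((S i).isOptimalBid_bid T s _ _).unique _ hv ht⟩, fun ω s _ t ht =>
    ⟨tendsto_priceIter S hα_pos hα_lim hα_sum T s _ _ ht,
      tendsto_bidIter S hα_pos hα_lim hα_sum T s _ _ ht⟩, fun ω s _ =>
    ⟨(heq ω s).optimal, (heq ω s).clears, (heq ω s).dualFunction_le⟩, ?_, hadm,
    ⟨⟨_, hadm, rfl⟩, ?_⟩, fun i t ht => ?_, fun i => ⟨hUint i, fun V hV hV2 =>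
      hbest i hV hV2⟩⟩
  · rw [expectedCost_eq_ofReal hnoise hU2]
    exact ENNReal.ofReal_ne_top
  · rintro _ ⟨V, hV, rfl⟩
    exact EReal.neg_le_neg_iff.2 <| EReal.coe_ennreal_le_coe_ennreal_iff.2 <|
      expectedCost_le_of_bestResponse hnoise hadm hV hU2 hUint fun i hV2 =>
        hbest i (hV.adapted i) hV2
  · rw [funext fun ω => hL t ht ω i]
    exact (L t i).continuous_of_finiteDimensional.measurable.comp
      (measurable_schemeState hK ht.le)
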